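/- **Definitions.** Let $\Sigma$ be a finite alphabet; all languages are subsets of $\Sigma^*$. A *parsing expression grammar* (PEG) over $\Sigma$ consists of a finite set $N$ of nonterminals (disjoint from $\Sigma$), an axiom $S\in N$, and exactly one rule $A\leftarrow e_A$ for each $A\in N$, where $e_A$ is a parsing expression. Parsing expressions are built from the empty word $\varepsilon$, letters $a\in\Sigma$ and nonterminals $A\in N$ by sequence $e_1e_2$, prioritized choice $e_1/e_2$ and the not-predicate $!e$. The partial function $R$, which assigns to an expression and a word either a word (the unparsed suffix) or the failure symbol $\mathbf F$, is defined recursively by - $R(\varepsilon,w)=w$, $R(a,as)=s$, and $R(a,bs)=R(a,\varepsilon)=\mathbf F$ for $b\neq a$; - $R(A,w)=R(e_A,w)$; - $R(e_1e_2,w)=R(e_2,R(e_1,w))$ if $R(e_1,w)\ne\mathbf F$, and $R(e_1e_2,w)=\mathbf F$ if $R(e_1,w)=\mathbf F$; - $R(e_1/e_2,w)=R(e_1,w)$ if $R(e_1,w)\neq\mathbf F$, and $R(e_1/e_2,w)=R(e_2,w)$ if $R(e_1,w)=\mathbf F$; - $R(!e,w)=w$ if $R(e,w)=\mathbf F$,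 and $R(!e,w)=\mathbf F$ if $R(e,w)\in\Sigma^*$; it is undefined where this recursion does not terminate. The PEG generates the language $\{w\in\Sigma^* : R(S,w)=\varepsilon\}$. Let $\mathsf{PEL}$ be the class of all languages over $\Sigma$ generated by PEGs, and $\mathsf{DCFL}$ the class of all languages over $\Sigma$ accepted by final state by deterministic pushdown automata (with moves on the empty word allowed). For classes $\mathscr L,\mathscr M$ of languages over $\Sigma$: - the *regular closure* $\Gamma_{\mathsf{REG}}(\mathscr L)$ consists of all languages obtained from a regular expression over some finite alphabet $\{a_1,\dots,a_m\}$ by replacing each letter $a_i$ by a language $L_{a_i}\in\mathscr L$; - the *Boolean closure* $\Gamma_{\mathsf{Bool}}(\mathscr L)$ is the smallest class of languages over $\Sigma$ that contains $\mathscr L$ and is closed under union, intersection and complement in $\Sigma^*$; - $\mathscr L\cdot\mathscr M=\{XY : X\in\mathscr L,\ Y\in\mathscr M\}$, where $XY=\{xy : x\in X,\ y\in Y\}$. **Theorem.** For every finite alphabet $\Sigma$: 1. $\Gamma_{\mathsf{Bool}}(\Gamma_{\mathsf{REG}}(\mathsf{DCFL}))\subseteq\mathsf{PEL}$. 2. $\Gamma_{\mathsf{REG}}(\mathsf{DCFL})\cdot\mathsf{PEL}=\mathsf{PEL}$.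 -/

import Mathlib

universe u v

/-! ## Parsing expression grammars -/

/-- Parsing expressions over the terminal alphabet `α` and the set of nonterminals `N`. -/
inductive PExpr (α : Type u) (N : Type v) : Type (max u v)
  | eps : PExpr α N
  | terminal (a : α) : PExpr α N
  | nonterminal (A : N) : PExpr α N
  | seq (e₁ e₂ : PExpr α N) : PExpr α N
  | choice (e₁ e₂ : PExpr α N) : PExpr α N
  | notPred (e : PExpr α N) : PExpr α N

/-- A parsing expression grammar over the terminal alphabet `α`: a finite set of nonterminals,
exactly one rule for each nonterminal, and an axiom. -/
structure PEG (α : Type u) where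
  NT : Type
  finite_NT : Finite NT
  rule : NT → PExpr α NT
  start : NT

namespace PEG

variable {α : Type u}

/-- The graph of the partial function `R : E × Σ* → Σ* ∪ {F}`. `G.Parses e w (some s)` says
`R(e, w) = s`, where `s` is the unparsed suffix of `w`; `G.Parses e w none` says `R(e, w) = F`.
As the relation is inductive, no result is assigned when the recursion does not terminate. -/
inductive Parses (G : PEG α) : PExpr α G.NT → List α → Option (List α) → Prop
  | eps (w : List α) : Parses G .eps w (some w)
  | terminal_match (a : α) (s : List α) : Parses G (.terminal a) (a :: s) (some s)
  | terminal_mismatch (a b : α) (s : List α) (hab : a ≠ b) :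
      Parses G (.terminal a) (b :: s) none
  | terminal_nil (a : α) : Parses G (.terminal a) [] none
  | nonterminal (A : G.NT) (w : List α) (r : Option (List α)) (h : Parses G (G.rule A) w r) :
      Parses G (.nonterminal A) w r
  | seq_success (e₁ e₂ : PExpr α G.NT) (w s : List α) (r : Option (List α))
      (h₁ : Parses G e₁ w (some s)) (h₂ : Parses G e₂ s r) : Parses G (.seq e₁ e₂) w r
  | seq_failure (e₁ e₂ : PExpr α G.NT) (w : List α)
      (h₁ : Parses G e₁ w none) : Parses G (.seq e₁ e₂) w none
  | choice_first (e₁ e₂ : PExpr α G.NT) (w s : List α)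
      (h₁ : Parses G e₁ w (some s)) : Parses G (.choice e₁ e₂) w (some s)
  | choice_second (e₁ e₂ : PExpr α G.NT) (w : List α) (r : Option (List α))
      (h₁ : Parses G e₁ w none) (h₂ : Parses G e₂ w r) : Parses G (.choice e₁ e₂) w r
  | notPred_success (e : PExpr α G.NT) (w : List α)
      (h : Parses G e w none) : Parses G (.notPred e) w (some w)
  | notPred_failure (e : PExpr α G.NT) (w s : List α)
      (h : Parses G e w (some s)) : Parses G (.notPred e) w none

/-- The language generated by a PEG: the words `w` with `R(S, w) = ε`. -/
def language (G : PEG α) : Language α :=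
  {w : List α | G.Parses (.nonterminal G.start) w (some [])}

end PEG

/-- The class of parsing expression languages over `α`. -/
def PEL (α : Type u) : Set (Language α) :=
  {L | ∃ G : PEG α, G.language = L}

/-! ## Deterministic pushdown automata -/

/-- A deterministic pushdown automaton with input alphabet `α`. `step q (some a) Z` is the move that
reads the letter `a`, `step q none Z` is the move on the empty word (`none` as a value: no move).
A move replaces the top symbol `Z` of the stack by a word, whose first letter becomes the new top.
If there is a move on the empty word for `q` and `Z`, there is none that reads a letter. -/
structure DPDA (α : Type u) where
  State : Type
  StackSym : Type
  finite_State : Finite State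
  finite_StackSym : Finite StackSym
  step : State → Option α → StackSym → Option (State × List StackSym)
  start : State
  bottom : StackSym
  accept : Set State
  deterministic : ∀ (q : State) (Z : StackSym),
    step q none Z ≠ none → ∀ a : α, step q (some a) Z = none

namespace DPDA

variable {α : Type u}

/-- A configuration: the state, the unread part of the input, and the stack (top first). -/
abbrev Config (M : DPDA α) : Type u := M.State × List α × List M.StackSym

/-- One move of the automaton. -/
inductive Move (M : DPDA α) : M.Config → M.Config → Prop
  | read (q p : M.State) (a : α) (w : List α) (Z : M.StackSym) (β γ : List M.StackSym)
      (h : M.step q (some a) Z = some (p, β)) : Move M (q, a :: w, Z :: γ) (p, w, β ++ γ)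
  | epsilon (q p : M.State) (w : List α) (Z : M.StackSym) (β γ : List M.StackSym)
      (h : M.step q none Z = some (p, β)) : Move M (q, w, Z :: γ) (p, w, β ++ γ)

/-- The language accepted by final state: the words after whose complete reading the automaton can
be in an accepting state (with any stack). -/
def language (M : DPDA α) : Language α :=
  {w : List α | ∃ q ∈ M.accept, ∃ γ : List M.StackSym,
    Relation.ReflTransGen M.Move (M.start, w, [M.bottom]) (q, [], γ)}

end DPDA

/-- The class of deterministic context-free languages over `α`. -/
def DCFL (α : Type u) : Set (Language α) :=
  {L | ∃ M : DPDA α, M.language = L}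

/-! ## Closures of language classes -/

/-- The language described by a regular expression over `σ` after each letter `i` has been
replaced by the language `f i`. -/
def RegularExpression.substLanguage {σ : Type v} {α : Type u} (f : σ → Language α) :
    RegularExpression σ → Language α
  | .zero => 0
  | .epsilon => 1
  | .char i => f i
  | .plus P Q => P.substLanguage f + Q.substLanguage f
  | .comp P Q => P.substLanguage f * Q.substLanguage f
  | .star P => KStar.kstar (P.substLanguage f)

/-- The regular closure of a class of languages: the languages obtained from a regular expression
over a finite alphabet by replacing its letters by languages of the class. -/
def regClosure {α : Type u} (C : Set (Language α)) : Set (Language α) :=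
  {L | ∃ (m : ℕ) (R : RegularExpression (Fin m)) (f : Fin m → Language α),
    (∀ i, f i ∈ C) ∧ R.substLanguage f = L}

/-- The Boolean closure of a class of languages: the smallest class that contains it and is closed
under union, intersection and complement (relative to all words over `α`). -/
inductive boolClosure {α : Type u} (C : Set (Language α)) : Set (Language α)
  | base (A : Language α) (hA : A ∈ C) : boolClosure C A
  | union (A B : Language α) (hA : boolClosure C A) (hB : boolClosure C B) : boolClosure C (A ⊔ B)
  | inter (A B : Language α) (hA : boolClosure C A) (hB : boolClosure C B) : boolClosure C (A ⊓ B)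
  | compl (A : Language α) (hA : boolClosure C A) : boolClosure C Aᶜ

/-- The concatenation of two classes of languages: all products `X * Y` with `X` in the first class
and `Y` in the second. -/
def concatClass {α : Type u} (C D : Set (Language α)) : Set (Language α) :=
  {L | ∃ X ∈ C, ∃ Y ∈ D, X * Y = L}

/-! The proof rests on expressions that always halt and consume nothing, that is, on tests. Among
tests prioritized choice is plain disjunction and `!` is negation, so Boolean closure is immediate
once every parsing expression language is known to be decided by a test (`PEG.mem_PEL_iff`).

The obstacle is non-termination. It occurs only through left recursion: a nonterminal is entered
again at the position where it is already being evaluated. The grammar is rebuilt so that each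
nonterminal carries the set of nonterminals pending at the current position and fails when one of
them recurs. Since `!` turns failure into success, success without consumption, success with
consumption and failure are probed separately, and divergence becomes failure of all three probes
(`PEG.probed`).

For a product of a regular expression `R` over DCFLs with a language `X`, finitely many sequences
`k` of subexpressions remain to be matched after some factors of `R` have been read. Their languages
`Y k` satisfy a finite system: `Y k` is the union of `X`, if `k` can be dropped, and of products of
a DCFL without the empty word and some `Y k'` (`RegularExpression.mem_seqLanguage_iff`). Determinism
makes the run of an automaton on a given input unique, so a PEG can follow it: `pop q Z p` consumes
exactly what is read while `Z` is removed, and `find k q Z` looks along the run, after at least one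
letter, for an accepting moment whose remaining input is in `Y k`. Where a factor ends is not
guessed, because the remaining input is tested by lookahead at accepting moments. Moves on the empty
word are resolved when the grammar is built, so each evaluation reads a letter before it recurs, and
correctness follows by induction on the length of the input (`DPDASystem.IsSolution.correctAt`).
Boolean closure then gives the first claim, with `X` the empty word. -/

/-! ### Calculus of expressions with total results -/

namespace PExpr

variable {α : Type u} {N N' : Type v}

/-- The expression that always fails. -/
def fail : PExpr α N := .notPred .eps

/-- The and-predicate. -/
def andPred (e : PExpr α N) : PExpr α N := .notPred (.notPred e)

/-- The prioritized choice among a list of expressions. -/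
def anyOf : List (PExpr α N) → PExpr α N
  | [] => fail
  | e :: l => .choice e (anyOf l)

/-- The expression `ε` if `p` holds, and the failing expression otherwise. -/
noncomputable def guard (p : Prop) : PExpr α N := open Classical in if p then .eps else fail

/-- Renaming of nonterminals. -/
def mapNT (f : N → N') : PExpr α N → PExpr α N'
  | .eps => .eps
  | .terminal a => .terminal a
  | .nonterminal A => .nonterminal (f A)
  | .seq e₁ e₂ => .seq (e₁.mapNT f) (e₂.mapNT f)
  | .choice e₁ e₂ => .choice (e₁.mapNT f) (e₂.mapNT f)
  | .notPred e => .notPred (e.mapNT f)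

end PExpr

/-- A list of all elements of a finite type. -/
noncomputable def allElems (β : Type*) [Finite β] : List β :=
  (@Finset.univ β (Fintype.ofFinite β)).toList

theorem mem_allElems {β : Type*} [Finite β] (b : β) : b ∈ allElems β := by
  simp [allElems]

/-- The expression that consumes an arbitrary letter. -/
noncomputable def PExpr.anyLetter {α : Type u} {N : Type v} [Finite α] : PExpr α N :=
  .anyOf ((allElems α).map .terminal)

namespace PEG

variable {α : Type u} {G : PEG α}

theorem Parses.unique {e : PExpr α G.NT} {w : List α} {r r' : Option (List α)}
    (h : G.Parses e w r) (h' : G.Parses e w r') : r = r' := by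
  induction h generalizing r' with
  | eps w => cases h'; rfl
  | terminal_match a s =>
    cases h' with
    | terminal_match => rfl
    | terminal_mismatch _ _ _ hab => exact absurd rfl hab
  | terminal_mismatch a b s hab =>
    cases h' with
    | terminal_match => exact absurd rfl hab
    | terminal_mismatch => rfl
  | terminal_nil a => cases h'; rfl
  | nonterminal A w r h ih =>
    cases h' with
    | nonterminal _ _ _ h' => exact ih h'
  | seq_success e₁ e₂ w s r h₁ h₂ ih₁ ih₂ =>
    cases h' with
    | seq_success _ _ _ s' _ h₁' h₂' =>
      cases ih₁ h₁'
      exact ih₂ h₂'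
    | seq_failure _ _ _ h₁' => cases ih₁ h₁'
  | seq_failure e₁ e₂ w h₁ ih₁ =>
    cases h' with
    | seq_success _ _ _ s' _ h₁' h₂' => cases ih₁ h₁'
    | seq_failure _ _ _ h₁' => rfl
  | choice_first e₁ e₂ w s h₁ ih₁ =>
    cases h' with
    | choice_first _ _ _ _ h₁' => exact ih₁ h₁'
    | choice_second _ _ _ _ h₁' h₂' => cases ih₁ h₁'
  | choice_second e₁ e₂ w r h₁ h₂ ih₁ ih₂ =>
    cases h' with
    | choice_first _ _ _ _ h₁' => cases ih₁ h₁'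
    | choice_second _ _ _ _ h₁' h₂' => exact ih₂ h₂'
  | notPred_success e w h ih =>
    cases h' with
    | notPred_success => rfl
    | notPred_failure _ _ _ h' => cases ih h'
  | notPred_failure e w s h ih =>
    cases h' with
    | notPred_success _ _ h' => cases ih h'
    | notPred_failure => rfl

theorem Parses.mapNT {H : PEG α} {f : G.NT → H.NT}
    (hf : ∀ A, H.rule (f A) = (G.rule A).mapNT f) {e : PExpr α G.NT} {w : List α}
    {r : Option (List α)} (h : G.Parses e w r) : H.Parses (e.mapNT f) w r := by
  induction h with
  | eps w => exact .eps w
  | terminal_match a s => exact .terminal_match a s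
  | terminal_mismatch a b s hab => exact .terminal_mismatch a b s hab
  | terminal_nil a => exact .terminal_nil a
  | nonterminal A w r h ih => exact .nonterminal _ w r (hf A ▸ ih)
  | seq_success e₁ e₂ w s r h₁ h₂ ih₁ ih₂ => exact .seq_success _ _ w s r ih₁ ih₂
  | seq_failure e₁ e₂ w h₁ ih₁ => exact .seq_failure _ _ w ih₁
  | choice_first e₁ e₂ w s h₁ ih₁ => exact .choice_first _ _ w s ih₁
  | choice_second e₁ e₂ w r h₁ h₂ ih₁ ih₂ => exact .choice_second _ _ w r ih₁ ih₂
  | notPred_success e w h ih => exact .notPred_success _ w ih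
  | notPred_failure e w s h ih => exact .notPred_failure _ w s ih

/-! ### Total specifications of the result of an expression -/

/-- The expression `e` succeeds on `w` with exactly the suffixes that satisfy `S`, and fails on `w`
if there are none. -/
def Yields (G : PEG α) (e : PExpr α G.NT) (w : List α) (S : List α → Prop) : Prop :=
  (∀ s, S s → G.Parses e w (some s)) ∧ ((∀ s, ¬ S s) → G.Parses e w none)

/-- On `w` the expression `e` succeeds without consuming input if `p` holds, and fails otherwise. -/
def Tests (G : PEG α) (e : PExpr α G.NT) (w : List α) (p : Prop) : Prop :=
  G.Yields e w fun s => s = w ∧ p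

theorem tests_iff {e : PExpr α G.NT} {w : List α} {p : Prop} :
    G.Tests e w p ↔ (p → G.Parses e w (some w)) ∧ (¬ p → G.Parses e w none) := by
  unfold Tests Yields
  constructor
  · rintro ⟨h, h'⟩
    exact ⟨fun hp => h w ⟨rfl, hp⟩, fun hp => h' fun s hs => hp hs.2⟩
  · rintro ⟨h, h'⟩
    refine ⟨?_, fun hs => h' fun hp => hs w ⟨rfl, hp⟩⟩
    rintro s ⟨rfl, hp⟩
    exact h hp

theorem Yields.congr {e : PExpr α G.NT} {w : List α} {S T : List α → Prop}
    (h : G.Yields e w S) (hST : ∀ s, S s ↔ T s) : G.Yields e w T := by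
  have : S = T := funext fun s => propext (hST s)
  exact this ▸ h

theorem Tests.congr {e : PExpr α G.NT} {w : List α} {p q : Prop}
    (h : G.Tests e w p) (hpq : p ↔ q) : G.Tests e w q :=
  propext hpq ▸ h

theorem Yields.unique {e : PExpr α G.NT} {w s t : List α} {S : List α → Prop}
    (h : G.Yields e w S) (hs : S s) (ht : S t) : s = t :=
  Option.some.inj ((h.1 s hs).unique (h.1 t ht))

theorem Yields.nonterminal {A : G.NT} {w : List α} {S : List α → Prop}
    (h : G.Yields (G.rule A) w S) : G.Yields (.nonterminal A) w S :=
  ⟨fun s hs => .nonterminal _ _ _ (h.1 s hs), fun hs => .nonterminal _ _ _ (h.2 hs)⟩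

theorem yields_eps (w : List α) : G.Yields .eps w (· = w) :=
  ⟨fun _ hs => hs ▸ .eps _, fun h => (h w rfl).elim⟩

theorem parses_fail (w : List α) : G.Parses .fail w none :=
  .notPred_failure _ _ w (.eps w)

theorem yields_fail (w : List α) : G.Yields .fail w fun _ => False :=
  ⟨fun _ hs => hs.elim, fun _ => parses_fail w⟩

theorem yields_terminal (a : α) (w : List α) :
    G.Yields (.terminal a) w fun s => w = a :: s := by
  refine ⟨?_, fun h => ?_⟩
  · rintro s rfl
    exact .terminal_match a s
  · cases w with
    | nil => exact .terminal_nil a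
    | cons b s =>
      by_cases hab : a = b
      · exact (h s (hab ▸ rfl)).elim
      · exact .terminal_mismatch a b s hab

theorem Yields.seq {e₁ e₂ : PExpr α G.NT} {w : List α} {S : List α → Prop}
    {T : List α → List α → Prop} (h₁ : G.Yields e₁ w S) (h₂ : ∀ s, S s → G.Yields e₂ s (T s)) :
    G.Yields (.seq e₁ e₂) w fun t => ∃ s, S s ∧ T s t := by
  refine ⟨?_, fun h => ?_⟩
  · rintro t ⟨s, hs, ht⟩
    exact .seq_success _ _ _ s _ (h₁.1 s hs) ((h₂ s hs).1 t ht)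
  · by_cases hS : ∃ s, S s
    · obtain ⟨s, hs⟩ := hS
      exact .seq_success _ _ _ s _ (h₁.1 s hs) ((h₂ s hs).2 fun t ht => h t ⟨s, hs, ht⟩)
    · exact .seq_failure _ _ _ (h₁.2 (not_exists.1 hS))

theorem Yields.notPred {e : PExpr α G.NT} {w : List α} {S : List α → Prop}
    (h : G.Yields e w S) : G.Tests (.notPred e) w (∀ s, ¬ S s) := by
  refine tests_iff.2 ⟨fun hS => .notPred_success _ _ (h.2 hS), fun hS => ?_⟩
  push Not at hS
  obtain ⟨s, hs⟩ := hS
  exact .notPred_failure _ _ s (h.1 s hs)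

theorem Yields.andPred {e : PExpr α G.NT} {w : List α} {S : List α → Prop}
    (h : G.Yields e w S) : G.Tests e.andPred w (∃ s, S s) :=
  (Yields.notPred h.notPred).congr (by simp)

theorem Tests.notPred {e : PExpr α G.NT} {w : List α} {p : Prop}
    (h : G.Tests e w p) : G.Tests (.notPred e) w (¬ p) :=
  (Yields.notPred h).congr (by simp)

theorem tests_guard (w : List α) (p : Prop) : G.Tests (.guard p) w p := by
  by_cases hp : p
  · exact tests_iff.2 ⟨fun _ => by simpa [PExpr.guard, hp] using .eps w, fun h => (h hp).elim⟩
  · exact tests_iff.2 ⟨fun h => (hp h).elim, fun _ => by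
      simpa [PExpr.guard, hp] using parses_fail w⟩

theorem Tests.seq {e₁ e₂ : PExpr α G.NT} {w : List α} {p q : Prop}
    (h₁ : G.Tests e₁ w p) (h₂ : p → G.Tests e₂ w q) : G.Tests (.seq e₁ e₂) w (p ∧ q) := by
  refine (Yields.seq (T := fun _ s => s = w ∧ q) h₁ fun s hs => ?_).congr ?_
  · obtain ⟨rfl, hp⟩ := hs
    exact h₂ hp
  · intro s
    constructor
    · rintro ⟨_, ⟨rfl, hp⟩, rfl, hq⟩
      exact ⟨rfl, hp, hq⟩
    · rintro ⟨rfl, hp, hq⟩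
      exact ⟨s, ⟨rfl, hp⟩, rfl, hq⟩

/-- The order of the alternatives is irrelevant when those that succeed agree on the suffix, and the
others fail rather than diverge. Prioritized choice is then an unordered union. -/
theorem Yields.anyOf {ι : Type*} {l : List ι} {e : ι → PExpr α G.NT} {w : List α}
    {S : ι → List α → Prop} (h : ∀ i ∈ l, G.Yields (e i) w (S i))
    (hS : ∀ i ∈ l, ∀ j ∈ l, ∀ s t, S i s → S j t → s = t) :
    G.Yields (.anyOf (l.map e)) w fun s => ∃ i ∈ l, S i s := by
  induction l with
  | nil => exact (yields_fail w).congr (by simp)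
  | cons i l ih =>
    have ih := ih (fun j hj => h j (.tail _ hj))
      (fun j hj k hk => hS j (.tail _ hj) k (.tail _ hk))
    have hi := h i (.head _)
    refine ⟨?_, fun hs => ?_⟩
    · rintro s ⟨j, hj, hs⟩
      by_cases hex : ∃ t, S i t
      · obtain ⟨t, ht⟩ := hex
        cases hS i (.head _) j hj t s ht hs
        exact .choice_first _ _ _ _ (hi.1 _ ht)
      · refine .choice_second _ _ _ _ (hi.2 (not_exists.1 hex)) (ih.1 s ?_)
        rcases List.mem_cons.1 hj with rfl | hj
        · exact (hex ⟨s, hs⟩).elim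
        · exact ⟨j, hj, hs⟩
    · refine .choice_second _ _ _ _ (hi.2 fun s h' => hs s ⟨i, .head _, h'⟩) (ih.2 ?_)
      rintro s ⟨j, hj, h'⟩
      exact hs s ⟨j, .tail _ hj, h'⟩

/-- Successful tests all leave the whole input, so the agreement required by `Yields.anyOf` is
automatic. -/
theorem Tests.anyOf {ι : Type*} {l : List ι} {e : ι → PExpr α G.NT} {w : List α}
    {p : ι → Prop} (h : ∀ i ∈ l, G.Tests (e i) w (p i)) :
    G.Tests (.anyOf (l.map e)) w (∃ i ∈ l, p i) := by
  refine (Yields.anyOf h ?_).congr fun s => ?_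
  · rintro i _ j _ s t ⟨rfl, _⟩ ⟨rfl, _⟩
    rfl
  · constructor
    · rintro ⟨i, hi, rfl, hp⟩
      exact ⟨rfl, i, hi, hp⟩
    · rintro ⟨rfl, i, hi, hp⟩
      exact ⟨i, hi, rfl, hp⟩

theorem Tests.choice {e₁ e₂ : PExpr α G.NT} {w : List α} {p q : Prop}
    (h₁ : G.Tests e₁ w p) (h₂ : G.Tests e₂ w q) : G.Tests (.choice e₁ e₂) w (p ∨ q) := by
  rw [tests_iff] at *
  by_cases hp : p
  · exact ⟨fun _ => .choice_first _ _ _ _ (h₁.1 hp), fun h => (h (.inl hp)).elim⟩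
  · exact ⟨fun h => .choice_second _ _ _ _ (h₁.2 hp) (h₂.1 (h.resolve_left hp)),
      fun h => .choice_second _ _ _ _ (h₁.2 hp) (h₂.2 fun hq => h (.inr hq))⟩

theorem Yields.mapNT {H : PEG α} {f : G.NT → H.NT}
    (hf : ∀ A, H.rule (f A) = (G.rule A).mapNT f) {e : PExpr α G.NT} {w : List α}
    {S : List α → Prop} (h : G.Yields e w S) : H.Yields (e.mapNT f) w S :=
  ⟨fun s hs => (h.1 s hs).mapNT hf, fun hs => (h.2 hs).mapNT hf⟩

theorem yields_anyLetter [Finite α] (w : List α) :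
    G.Yields .anyLetter w fun s => ∃ a, w = a :: s := by
  refine (Yields.anyOf (fun a _ => yields_terminal a w) ?_).congr fun s => ?_
  · rintro a _ b _ s t rfl h
    cases h
    rfl
  · simp [mem_allElems]

end PEG

/-! ### Replacing divergence by failure -/

namespace PEG

variable {α : Type u} {G : PEG α}

/-- `G.ParsesIn n e w r` says that `G.Parses e w r` has a derivation with `n` inner steps. -/
inductive ParsesIn (G : PEG α) : ℕ → PExpr α G.NT → List α → Option (List α) → Prop
  | eps (w : List α) : ParsesIn G 0 .eps w (some w)
  | terminal (a : α) (w : List α) (r : Option (List α)) (h : G.Parses (.terminal a) w r) :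
      ParsesIn G 0 (.terminal a) w r
  | nonterminal (n : ℕ) (A : G.NT) (w : List α) (r : Option (List α))
      (h : ParsesIn G n (G.rule A) w r) : ParsesIn G (n + 1) (.nonterminal A) w r
  | seq_success (n m : ℕ) (e₁ e₂ : PExpr α G.NT) (w s : List α) (r : Option (List α))
      (h₁ : ParsesIn G n e₁ w (some s)) (h₂ : ParsesIn G m e₂ s r) :
      ParsesIn G (n + m + 1) (.seq e₁ e₂) w r
  | seq_failure (n : ℕ) (e₁ e₂ : PExpr α G.NT) (w : List α)
      (h₁ : ParsesIn G n e₁ w none) : ParsesIn G (n + 1) (.seq e₁ e₂) w none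
  | choice_first (n : ℕ) (e₁ e₂ : PExpr α G.NT) (w s : List α)
      (h₁ : ParsesIn G n e₁ w (some s)) : ParsesIn G (n + 1) (.choice e₁ e₂) w (some s)
  | choice_second (n m : ℕ) (e₁ e₂ : PExpr α G.NT) (w : List α) (r : Option (List α))
      (h₁ : ParsesIn G n e₁ w none) (h₂ : ParsesIn G m e₂ w r) :
      ParsesIn G (n + m + 1) (.choice e₁ e₂) w r
  | notPred_success (n : ℕ) (e : PExpr α G.NT) (w : List α)
      (h : ParsesIn G n e w none) : ParsesIn G (n + 1) (.notPred e) w (some w)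
  | notPred_failure (n : ℕ) (e : PExpr α G.NT) (w s : List α)
      (h : ParsesIn G n e w (some s)) : ParsesIn G (n + 1) (.notPred e) w none

theorem ParsesIn.parses {n : ℕ} {e : PExpr α G.NT} {w : List α} {r : Option (List α)}
    (h : G.ParsesIn n e w r) : G.Parses e w r := by
  induction h with
  | eps w => exact .eps w
  | terminal a w r h => exact h
  | nonterminal n A w r h ih => exact .nonterminal _ _ _ ih
  | seq_success n m e₁ e₂ w s r h₁ h₂ ih₁ ih₂ => exact .seq_success _ _ _ _ _ ih₁ ih₂
  | seq_failure n e₁ e₂ w h₁ ih₁ => exact .seq_failure _ _ _ ih₁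
  | choice_first n e₁ e₂ w s h₁ ih₁ => exact .choice_first _ _ _ _ ih₁
  | choice_second n m e₁ e₂ w r h₁ h₂ ih₁ ih₂ => exact .choice_second _ _ _ _ ih₁ ih₂
  | notPred_success n e w h ih => exact .notPred_success _ _ ih
  | notPred_failure n e w s h ih => exact .notPred_failure _ _ _ ih

theorem Parses.exists_parsesIn {e : PExpr α G.NT} {w : List α} {r : Option (List α)}
    (h : G.Parses e w r) : ∃ n, G.ParsesIn n e w r := by
  induction h with
  | eps w => exact ⟨0, .eps w⟩
  | terminal_match a s => exact ⟨0, .terminal _ _ _ (.terminal_match a s)⟩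
  | terminal_mismatch a b s hab => exact ⟨0, .terminal _ _ _ (.terminal_mismatch a b s hab)⟩
  | terminal_nil a => exact ⟨0, .terminal _ _ _ (.terminal_nil a)⟩
  | nonterminal A w r h ih =>
    obtain ⟨n, ih⟩ := ih
    exact ⟨_, .nonterminal _ _ _ _ ih⟩
  | seq_success e₁ e₂ w s r h₁ h₂ ih₁ ih₂ =>
    obtain ⟨n, ih₁⟩ := ih₁
    obtain ⟨m, ih₂⟩ := ih₂
    exact ⟨_, .seq_success _ _ _ _ _ _ _ ih₁ ih₂⟩
  | seq_failure e₁ e₂ w h₁ ih₁ =>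
    obtain ⟨n, ih₁⟩ := ih₁
    exact ⟨_, .seq_failure _ _ _ _ ih₁⟩
  | choice_first e₁ e₂ w s h₁ ih₁ =>
    obtain ⟨n, ih₁⟩ := ih₁
    exact ⟨_, .choice_first _ _ _ _ _ ih₁⟩
  | choice_second e₁ e₂ w r h₁ h₂ ih₁ ih₂ =>
    obtain ⟨n, ih₁⟩ := ih₁
    obtain ⟨m, ih₂⟩ := ih₂
    exact ⟨_, .choice_second _ _ _ _ _ _ ih₁ ih₂⟩
  | notPred_success e w h ih =>
    obtain ⟨n, ih⟩ := ih
    exact ⟨_, .notPred_success _ _ _ ih⟩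
  | notPred_failure e w s h ih =>
    obtain ⟨n, ih⟩ := ih
    exact ⟨_, .notPred_failure _ _ _ _ ih⟩

/-- The possible behaviours of an expression on a word: success without consuming input, success
with consuming input, and failure. -/
inductive Behaviour
  | stay
  | consume
  | fail

instance : Finite Behaviour :=
  Finite.of_surjective (fun i : Fin 3 => match i with
    | 0 => Behaviour.stay
    | 1 => Behaviour.consume
    | 2 => Behaviour.fail) (by
      rintro (_ | _ | _)
      exacts [⟨0, rfl⟩, ⟨1, rfl⟩, ⟨2, rfl⟩])

open Classical in
/-- The expression that succeeds exactly when `e` shows the given behaviour, and fails otherwise.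
The nonterminals in `V` are being evaluated at the current position already, so that the
evaluation of one of them does not terminate. -/
noncomputable def probe {N : Type} :
    Behaviour → Set N → PExpr α N → PExpr α (Behaviour × Set N × N)
  | .stay, _, .eps => .eps
  | _, _, .eps => .fail
  | .consume, _, .terminal a => .terminal a
  | .fail, _, .terminal a => .notPred (.terminal a)
  | .stay, _, .terminal _ => .fail
  | b, V, .nonterminal A => if A ∈ V then .fail else .nonterminal (b, V, A)
  | .stay, V, .seq e₁ e₂ => .seq (probe .stay V e₁) (probe .stay V e₂)
  | .consume, V, .seq e₁ e₂ =>
      .choice (.seq (probe .stay V e₁) (probe .consume V e₂))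
        (.seq (probe .consume V e₁) (.choice (probe .stay ∅ e₂) (probe .consume ∅ e₂)))
  | .fail, V, .seq e₁ e₂ =>
      .choice (probe .fail V e₁) (.choice (.seq (probe .stay V e₁) (probe .fail V e₂))
        (.andPred (.seq (probe .consume V e₁) (probe .fail ∅ e₂))))
  | .fail, V, .choice e₁ e₂ => .seq (probe .fail V e₁) (probe .fail V e₂)
  | b, V, .choice e₁ e₂ => .choice (probe b V e₁) (.seq (probe .fail V e₁) (probe b V e₂))
  | .stay, V, .notPred e => probe .fail V e
  | .consume, _, .notPred _ => .fail
  | .fail, V, .notPred e => .andPred (.choice (probe .stay V e) (probe .consume V e))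

/-- The grammar whose nonterminals probe the behaviour of the nonterminals of `G`. -/
noncomputable abbrev total (G : PEG α) : PEG α where
  NT := Behaviour × Set G.NT × G.NT
  finite_NT := by
    have := G.finite_NT
    infer_instance
  rule := fun ⟨b, V, A⟩ => probe b (insert A V) (G.rule A)
  start := (.stay, ∅, G.start)

/-- The results of the three probes of `e` on `w`, where `none` stands for non-termination. -/
inductive Probes (G : PEG α) (V : Set G.NT) (e : PExpr α G.NT) (w : List α) :
    Option (Option (List α)) → Prop
  | undef (h₁ : G.total.Parses (probe .stay V e) w none)
      (h₂ : G.total.Parses (probe .consume V e) w none)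
      (h₃ : G.total.Parses (probe .fail V e) w none) : Probes G V e w none
  | stay (h₁ : G.total.Parses (probe .stay V e) w (some w))
      (h₂ : G.total.Parses (probe .consume V e) w none)
      (h₃ : G.total.Parses (probe .fail V e) w none) : Probes G V e w (some (some w))
  | consume (s : List α) (hs : s.length < w.length)
      (h₁ : G.total.Parses (probe .stay V e) w none)
      (h₂ : G.total.Parses (probe .consume V e) w (some s))
      (h₃ : G.total.Parses (probe .fail V e) w none) : Probes G V e w (some (some s))
  | fail (h₁ : G.total.Parses (probe .stay V e) w none)
      (h₂ : G.total.Parses (probe .consume V e) w none)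
      (h₃ : G.total.Parses (probe .fail V e) w (some w)) : Probes G V e w (some none)

/-- The probes of `e` on `w` give a result of `e`, if they give any, and otherwise each derivation
of a result contains a derivation of a result of a nonterminal in `V`. -/
def Probed (G : PEG α) (V : Set G.NT) (e : PExpr α G.NT) (w : List α) : Prop :=
  (∃ r, G.Probes V e w (some r) ∧ G.Parses e w r) ∨
    (G.Probes V e w none ∧ ∀ n r, G.ParsesIn n e w r →
      ∃ B ∈ V, ∃ m ≤ n, ∃ r', G.ParsesIn m (.nonterminal B) w r')

theorem probed_eps (V : Set G.NT) (w : List α) : G.Probed V .eps w := by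
  refine .inl ⟨some w, .stay ?_ ?_ ?_, .eps w⟩ <;> simp only [probe]
  exacts [.eps w, parses_fail w, parses_fail w]

theorem probed_terminal (V : Set G.NT) (a : α) (w : List α) : G.Probed V (.terminal a) w := by
  have hfail : G.Parses (.terminal a) w none → G.total.Parses (.terminal a) w none →
      G.Probed V (.terminal a) w := by
    intro h h'
    refine .inl ⟨none, .fail ?_ ?_ ?_, h⟩ <;> simp only [probe]
    exacts [parses_fail w, h', .notPred_success _ _ h']
  cases w with
  | nil => exact hfail (.terminal_nil a) (.terminal_nil a)
  | cons b s =>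
    by_cases hab : a = b
    · subst hab
      refine .inl ⟨some s, .consume s (by simp) ?_ ?_ ?_, .terminal_match a s⟩ <;>
        simp only [probe]
      exacts [parses_fail _, .terminal_match a s, .notPred_failure _ _ s (.terminal_match a s)]
    · exact hfail (.terminal_mismatch a b s hab) (.terminal_mismatch a b s hab)

/-- The derivation at hand is its own witness, which is why `Probed` asks for `m ≤ n` and not `m <
n`. -/
theorem probed_nonterminal_of_mem {V : Set G.NT} {A : G.NT} (hA : A ∈ V) (w : List α) :
    G.Probed V (.nonterminal A) w := by
  refine .inr ⟨.undef ?_ ?_ ?_, fun n r h => ⟨A, hA, n, le_rfl, r, h⟩⟩ <;>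
    simpa only [probe, if_pos hA] using parses_fail w

/-- Infinite descent: if a derivation for `A` on `w` contains another one for `A` on `w`, the inner
one has fewer steps. So only nonterminals of `V` can be left at the bottom. -/
theorem Probed.nonterminal {V : Set G.NT} {A : G.NT} (hA : A ∉ V) {w : List α}
    (h : G.Probed (insert A V) (G.rule A) w) : G.Probed V (.nonterminal A) w := by
  have key : ∀ b r, G.total.Parses (probe b (insert A V) (G.rule A)) w r →
      G.total.Parses (probe b V (.nonterminal A)) w r := by
    intro b r h
    have h := Parses.nonterminal (G := G.total) (b, V, A) w r h
    simpa only [probe, if_neg hA] using h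
  have hprobes : ∀ o, G.Probes (insert A V) (G.rule A) w o → G.Probes V (.nonterminal A) w o := by
    intro o h
    cases h with
    | undef h₁ h₂ h₃ => exact .undef (key _ _ h₁) (key _ _ h₂) (key _ _ h₃)
    | stay h₁ h₂ h₃ => exact .stay (key _ _ h₁) (key _ _ h₂) (key _ _ h₃)
    | consume s hs h₁ h₂ h₃ => exact .consume s hs (key _ _ h₁) (key _ _ h₂) (key _ _ h₃)
    | fail h₁ h₂ h₃ => exact .fail (key _ _ h₁) (key _ _ h₂) (key _ _ h₃)
  rcases h with ⟨r, h, hr⟩ | ⟨h, hn⟩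
  · exact .inl ⟨r, hprobes _ h, .nonterminal _ _ _ hr⟩
  · refine .inr ⟨hprobes _ h, fun n => ?_⟩
    induction n using Nat.strong_induction_on with
    | _ n ih =>
      intro r hr
      cases hr with
      | nonterminal n _ _ _ hr =>
        obtain ⟨B, hB, m, hm, r', h'⟩ := hn n r hr
        -- If the nonterminal found is the one just unfolded, its derivation is strictly shorter and
        -- the induction applies.
        rcases hB with rfl | hB
        · obtain ⟨B', hB', m', hm', h''⟩ := ih m (by omega) r' h'
          exact ⟨B', hB', m', by omega, h''⟩
        · exact ⟨B, hB, m, by omega, r', h'⟩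


theorem Parses.andPred_success {e : PExpr α G.NT} {w s : List α}
    (h : G.Parses e w (some s)) : G.Parses e.andPred w (some w) :=
  .notPred_success _ _ (.notPred_failure _ _ s h)

theorem Parses.andPred_failure {e : PExpr α G.NT} {w : List α}
    (h : G.Parses e w none) : G.Parses e.andPred w none :=
  .notPred_failure _ _ w (.notPred_success _ _ h)

theorem Probed.notPred {V : Set G.NT} {e : PExpr α G.NT} {w : List α}
    (h : G.Probed V e w) : G.Probed V (.notPred e) w := by
  rcases h with ⟨r, h, hr⟩ | ⟨⟨h₁, h₂, h₃⟩, hn⟩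
  · cases h with
    | stay h₁ h₂ h₃ =>
      refine .inl ⟨none, .fail ?_ ?_ ?_, .notPred_failure _ _ _ hr⟩
      all_goals simp only [probe]
      exacts [h₃, parses_fail w, .andPred_success (.choice_first _ _ _ _ h₁)]
    | consume s hs h₁ h₂ h₃ =>
      refine .inl ⟨none, .fail ?_ ?_ ?_, .notPred_failure _ _ _ hr⟩
      all_goals simp only [probe]
      exacts [h₃, parses_fail w, .andPred_success (.choice_second _ _ _ _ h₁ h₂)]
    | fail h₁ h₂ h₃ =>
      refine .inl ⟨some w, .stay ?_ ?_ ?_, .notPred_success _ _ hr⟩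
      all_goals simp only [probe]
      exacts [h₃, parses_fail w, .andPred_failure (.choice_second _ _ _ _ h₁ h₂)]
  · refine .inr ⟨.undef ?_ ?_ ?_, fun n r h => ?_⟩
    any_goals simp only [probe]
    · exact h₃
    · exact parses_fail w
    · exact .andPred_failure (.choice_second _ _ _ _ h₁ h₂)
    · cases h with
      | notPred_success n _ _ h =>
        obtain ⟨B, hB, m, hm, h⟩ := hn n _ h
        exact ⟨B, hB, m, by omega, h⟩
      | notPred_failure n _ _ s h =>
        obtain ⟨B, hB, m, hm, h⟩ := hn n _ h
        exact ⟨B, hB, m, by omega, h⟩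

theorem Probed.choice {V : Set G.NT} {e₁ e₂ : PExpr α G.NT} {w : List α}
    (h₁ : G.Probed V e₁ w) (h₂ : G.Probed V e₂ w) : G.Probed V (.choice e₁ e₂) w := by
  rcases h₁ with ⟨r₁, h₁, hr₁⟩ | ⟨⟨_, _, _⟩, hn₁⟩
  · cases h₁ with
    | stay =>
      refine .inl ⟨_, .stay ?_ ?_ ?_, .choice_first _ _ _ _ hr₁⟩
      all_goals simp only [probe]
      all_goals
        solve_by_elim (maxDepth := 20) only [*, Parses.seq_success, Parses.seq_failure,
          Parses.choice_first, Parses.choice_second, Parses.andPred_success,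
          Parses.andPred_failure]
    | consume s hs =>
      refine .inl ⟨_, .consume s hs ?_ ?_ ?_, .choice_first _ _ _ _ hr₁⟩
      all_goals simp only [probe]
      all_goals
        solve_by_elim (maxDepth := 20) only [*, Parses.seq_success, Parses.seq_failure,
          Parses.choice_first, Parses.choice_second, Parses.andPred_success,
          Parses.andPred_failure]
    | fail =>
      rcases h₂ with ⟨r₂, h₂, hr₂⟩ | ⟨⟨_, _, _⟩, hn₂⟩
      · refine .inl ⟨r₂, ?_, .choice_second _ _ _ _ hr₁ hr₂⟩
        cases h₂ with
        | stay =>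
          refine .stay ?_ ?_ ?_
          all_goals simp only [probe]
          all_goals
            solve_by_elim (maxDepth := 20) only [*, Parses.seq_success, Parses.seq_failure,
              Parses.choice_first, Parses.choice_second, Parses.andPred_success,
              Parses.andPred_failure]
        | consume s hs =>
          refine .consume s hs ?_ ?_ ?_
          all_goals simp only [probe]
          all_goals
            solve_by_elim (maxDepth := 20) only [*, Parses.seq_success, Parses.seq_failure,
              Parses.choice_first, Parses.choice_second, Parses.andPred_success,
              Parses.andPred_failure]
        | fail =>
          refine .fail ?_ ?_ ?_
          all_goals simp only [probe]
          all_goals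
            solve_by_elim (maxDepth := 20) only [*, Parses.seq_success, Parses.seq_failure,
              Parses.choice_first, Parses.choice_second, Parses.andPred_success,
              Parses.andPred_failure]
      · refine .inr ⟨.undef ?_ ?_ ?_, fun n r h => ?_⟩
        any_goals simp only [probe]
        iterate 3
          solve_by_elim (maxDepth := 20) only [*, Parses.seq_success, Parses.seq_failure,
      Parses.choice_first, Parses.choice_second, Parses.andPred_success,
      Parses.andPred_failure]
        cases h with
        | choice_first n _ _ _ s h => cases hr₁.unique h.parses
        | choice_second n k _ _ _ _ _ h =>
          obtain ⟨B, hB, m, hm, h⟩ := hn₂ k _ h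
          exact ⟨B, hB, m, by omega, h⟩
  · refine .inr ⟨.undef ?_ ?_ ?_, fun n r h => ?_⟩
    any_goals simp only [probe]
    iterate 3
      solve_by_elim (maxDepth := 20) only [*, Parses.seq_success, Parses.seq_failure,
      Parses.choice_first, Parses.choice_second, Parses.andPred_success,
      Parses.andPred_failure]
    cases h with
    | choice_first n _ _ _ s h =>
      obtain ⟨B, hB, m, hm, h⟩ := hn₁ n _ h
      exact ⟨B, hB, m, by omega, h⟩
    | choice_second n k _ _ _ _ h =>
      obtain ⟨B, hB, m, hm, h⟩ := hn₁ n _ h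
      exact ⟨B, hB, m, by omega, h⟩

/-- If `e₁` consumes nothing, `e₂` starts at the same position with the same pending nonterminals.
If `e₁` consumes something, `e₂` starts on a shorter word where nothing is pending. -/
theorem Probed.seq {V : Set G.NT} {e₁ e₂ : PExpr α G.NT} {w : List α}
    (h₁ : G.Probed V e₁ w) (h₂ : G.Probed V e₂ w)
    (h₃ : ∀ s : List α, s.length < w.length → G.Probed ∅ e₂ s) : G.Probed V (.seq e₁ e₂) w := by
  rcases h₁ with ⟨r₁, h₁, hr₁⟩ | ⟨⟨_, _, _⟩, hn₁⟩
  · cases h₁ with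
    | stay =>
      rcases h₂ with ⟨r₂, h₂, hr₂⟩ | ⟨⟨_, _, _⟩, hn₂⟩
      · refine .inl ⟨r₂, ?_, .seq_success _ _ _ _ _ hr₁ hr₂⟩
        cases h₂ with
        | stay =>
          refine .stay ?_ ?_ ?_
          all_goals simp only [probe]
          all_goals
            solve_by_elim (maxDepth := 20) only [*, Parses.seq_success, Parses.seq_failure,
              Parses.choice_first, Parses.choice_second, Parses.andPred_success,
              Parses.andPred_failure]
        | consume s hs =>
          refine .consume s hs ?_ ?_ ?_
          all_goals simp only [probe]
          all_goals
            solve_by_elim (maxDepth := 20) only [*, Parses.seq_success, Parses.seq_failure,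
              Parses.choice_first, Parses.choice_second, Parses.andPred_success,
              Parses.andPred_failure]
        | fail =>
          refine .fail ?_ ?_ ?_
          all_goals simp only [probe]
          all_goals
            solve_by_elim (maxDepth := 20) only [*, Parses.seq_success, Parses.seq_failure,
              Parses.choice_first, Parses.choice_second, Parses.andPred_success,
              Parses.andPred_failure]
      · refine .inr ⟨.undef ?_ ?_ ?_, fun n r h => ?_⟩
        any_goals simp only [probe]
        iterate 3
          solve_by_elim (maxDepth := 20) only [*, Parses.seq_success, Parses.seq_failure,
      Parses.choice_first, Parses.choice_second, Parses.andPred_success,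
      Parses.andPred_failure]
        cases h with
        | seq_failure n _ _ _ h => cases hr₁.unique h.parses
        | seq_success n k _ _ _ s _ h h' =>
          cases hr₁.unique h.parses
          obtain ⟨B, hB, m, hm, h⟩ := hn₂ k _ h'
          exact ⟨B, hB, m, by omega, h⟩
    | consume s hs =>
      rcases h₃ s hs with ⟨r₂, h₂, hr₂⟩ | ⟨⟨_, _, _⟩, hn₂⟩
      · refine .inl ⟨r₂, ?_, .seq_success _ _ _ _ _ hr₁ hr₂⟩
        cases h₂ with
        | stay =>
          refine .consume s hs ?_ ?_ ?_
          all_goals simp only [probe]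
          all_goals
            solve_by_elim (maxDepth := 20) only [*, Parses.seq_success, Parses.seq_failure,
              Parses.choice_first, Parses.choice_second, Parses.andPred_success,
              Parses.andPred_failure]
        | consume t ht =>
          refine .consume t (ht.trans hs) ?_ ?_ ?_
          all_goals simp only [probe]
          all_goals
            solve_by_elim (maxDepth := 20) only [*, Parses.seq_success, Parses.seq_failure,
              Parses.choice_first, Parses.choice_second, Parses.andPred_success,
              Parses.andPred_failure]
        | fail =>
          refine .fail ?_ ?_ ?_
          all_goals simp only [probe]
          all_goals
            solve_by_elim (maxDepth := 20) only [*, Parses.seq_success, Parses.seq_failure,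
              Parses.choice_first, Parses.choice_second, Parses.andPred_success,
              Parses.andPred_failure]
      · refine .inr ⟨.undef ?_ ?_ ?_, fun n r h => ?_⟩
        any_goals simp only [probe]
        iterate 3
          solve_by_elim (maxDepth := 20) only [*, Parses.seq_success, Parses.seq_failure,
      Parses.choice_first, Parses.choice_second, Parses.andPred_success,
      Parses.andPred_failure]
        cases h with
        | seq_failure n _ _ _ h => cases hr₁.unique h.parses
        | seq_success n k _ _ _ s _ h h' =>
          cases hr₁.unique h.parses
          -- With no pending nonterminal, `e₂` has no derivation at all on `s`.
          obtain ⟨B, hB, _⟩ := hn₂ k _ h'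
          exact hB.elim
    | fail =>
      refine .inl ⟨_, .fail ?_ ?_ ?_, .seq_failure _ _ _ hr₁⟩
      all_goals simp only [probe]
      all_goals
        solve_by_elim (maxDepth := 20) only [*, Parses.seq_success, Parses.seq_failure,
          Parses.choice_first, Parses.choice_second, Parses.andPred_success,
          Parses.andPred_failure]
  · refine .inr ⟨.undef ?_ ?_ ?_, fun n r h => ?_⟩
    any_goals simp only [probe]
    iterate 3
      solve_by_elim (maxDepth := 20) only [*, Parses.seq_success, Parses.seq_failure,
      Parses.choice_first, Parses.choice_second, Parses.andPred_success,
      Parses.andPred_failure]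
    cases h with
    | seq_failure n _ _ _ h =>
      obtain ⟨B, hB, m, hm, h⟩ := hn₁ n _ h
      exact ⟨B, hB, m, by omega, h⟩
    | seq_success n k _ _ _ _ _ h =>
      obtain ⟨B, hB, m, hm, h⟩ := hn₁ n _ h
      exact ⟨B, hB, m, by omega, h⟩

/-- The recursion is lexicographic: consumption shortens the word and may reset `V`; at a fixed
position, unfolding a nonterminal enlarges `V` within a finite set; otherwise the expression
shrinks. -/
theorem probed (V : Set G.NT) (e : PExpr α G.NT) (w : List α) : G.Probed V e w := by
  have := G.finite_NT
  match e with
  | .eps => exact probed_eps V w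
  | .terminal a => exact probed_terminal V a w
  | .nonterminal A =>
    by_cases hA : A ∈ V
    · exact probed_nonterminal_of_mem hA w
    · have : (insert A V)ᶜ.ncard < Vᶜ.ncard :=
        Set.ncard_lt_ncard (compl_lt_compl_iff_lt.2 (Set.ssubset_insert hA)) (Set.toFinite _)
      exact (probed (insert A V) (G.rule A) w).nonterminal hA
  | .seq e₁ e₂ => exact (probed V e₁ w).seq (probed V e₂ w) fun s hs => probed ∅ e₂ s
  | .choice e₁ e₂ => exact (probed V e₁ w).choice (probed V e₂ w)
  | .notPred e => exact (probed V e w).notPred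
termination_by (w.length, Vᶜ.ncard, sizeOf e)

/-- Every expression of `G` has a counterpart in the grammar `G.total` with the same successes,
which fails wherever the expression gives no result. -/
theorem exists_yields_total (e : PExpr α G.NT) :
    ∃ e' : PExpr α G.total.NT, ∀ w, G.total.Yields e' w fun s => G.Parses e w (some s) := by
  -- Leaving out the failure probe merges failure of `e` with divergence of `e`.
  refine ⟨.choice (probe .stay ∅ e) (probe .consume ∅ e), fun w => ?_⟩
  rcases G.probed ∅ e w with ⟨r, h, hr⟩ | ⟨⟨h₁, h₂, -⟩, hn⟩
  · cases h with
    | stay h₁ h₂ =>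
      refine ⟨fun s hs => ?_, fun h => (h w hr).elim⟩
      cases hr.unique hs
      exact .choice_first _ _ _ _ h₁
    | consume s hs h₁ h₂ =>
      refine ⟨fun s hs => ?_, fun h => (h s hr).elim⟩
      cases hr.unique hs
      exact .choice_second _ _ _ _ h₁ h₂
    | fail h₁ h₂ =>
      exact ⟨fun s hs => (nomatch hr.unique hs), fun _ => .choice_second _ _ _ _ h₁ h₂⟩
  · refine ⟨fun s hs => ?_, fun _ => .choice_second _ _ _ _ h₁ h₂⟩
    obtain ⟨n, hs⟩ := hs.exists_parsesIn
    obtain ⟨B, hB, _⟩ := hn n _ hs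
    exact hB.elim

end PEG

/-! ### Membership tests and Boolean closure -/

namespace PEG

variable {α : Type u}

/-- The disjoint union of two grammars. -/
def sum (G H : PEG α) : PEG α where
  NT := G.NT ⊕ H.NT
  finite_NT := by
    have := G.finite_NT
    have := H.finite_NT
    infer_instance
  rule
    | .inl A => (G.rule A).mapNT .inl
    | .inr A => (H.rule A).mapNT .inr
  start := .inl G.start

variable [Finite α]

/-- The extension of `G` by a new axiom, which consumes the whole word if `e` succeeds. -/
noncomputable def consumeAfter (G : PEG α) (e : PExpr α G.NT) : PEG α where
  NT := G.NT ⊕ Bool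
  finite_NT := by
    have := G.finite_NT
    infer_instance
  rule
    | .inl A => (G.rule A).mapNT .inl
    | .inr true => .seq (e.mapNT .inl) (.nonterminal (.inr false))
    | .inr false => .choice (.seq .anyLetter (.nonterminal (.inr false))) .eps
  start := .inr true

theorem parses_consumeAfter_rest (G : PEG α) (e : PExpr α G.NT) (w : List α) :
    (G.consumeAfter e).Parses (.nonterminal (.inr false)) w (some []) := by
  induction w with
  | nil =>
    exact .nonterminal _ _ _ (.choice_second _ _ _ _
      (.seq_failure _ _ _ ((yields_anyLetter []).2 (by simp))) (.eps []))
  | cons a w ih =>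
    exact .nonterminal _ _ _ (.choice_first _ _ _ _
      (.seq_success _ _ _ w _ ((yields_anyLetter _).1 w ⟨a, rfl⟩) ih))

/-- A language is a parsing expression language iff some expression
of some grammar tests membership of each word. -/
theorem mem_PEL_iff {X : Language α} :
    X ∈ PEL α ↔ ∃ (G : PEG α) (e : PExpr α G.NT), ∀ w, G.Tests e w (w ∈ X) := by
  constructor
  · rintro ⟨G, rfl⟩
    obtain ⟨e, he⟩ := exists_yields_total (.nonterminal G.start)
    -- `!anyLetter` checks that the input is used up; the and-predicate then gives it back.
    refine ⟨G.total, (PExpr.seq e (.notPred .anyLetter)).andPred, fun w => ?_⟩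
    refine ((he w).seq fun s _ => (yields_anyLetter s).notPred).andPred.congr ?_
    constructor
    · rintro ⟨s, _, hs, rfl, h⟩
      cases s with
      | nil => exact hs
      | cons a s => exact (h s ⟨a, rfl⟩).elim
    · intro h
      exact ⟨[], [], h, rfl, by simp⟩
  · rintro ⟨G, e, he⟩
    refine ⟨G.consumeAfter e, ?_⟩
    ext w
    have hw := tests_iff.1 ((he w).mapNT (H := G.consumeAfter e) (f := .inl) fun _ => rfl)
    constructor
    · intro h
      by_contra hX
      cases h.unique (.nonterminal _ _ _ (.seq_failure _ _ _ (hw.2 hX)))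
    · intro hX
      exact .nonterminal _ _ _
        (.seq_success _ _ _ w _ (hw.1 hX) (parses_consumeAfter_rest G e w))

/-- This is where totality pays off: `!e` succeeds on every word outside `X` only because `e` fails
there instead of diverging. -/
theorem compl_mem_PEL {X : Language α} (hX : X ∈ PEL α) : Xᶜ ∈ PEL α := by
  obtain ⟨G, e, he⟩ := mem_PEL_iff.1 hX
  exact mem_PEL_iff.2 ⟨G, .notPred e, fun w => (he w).notPred⟩

theorem sup_mem_PEL {X Y : Language α} (hX : X ∈ PEL α) (hY : Y ∈ PEL α) : X ⊔ Y ∈ PEL α := by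
  obtain ⟨G, e, he⟩ := mem_PEL_iff.1 hX
  obtain ⟨H, e', he'⟩ := mem_PEL_iff.1 hY
  exact mem_PEL_iff.2 ⟨G.sum H, .choice (e.mapNT .inl) (e'.mapNT .inr), fun w =>
    Tests.choice (Yields.mapNT (fun _ => rfl) (he w)) (Yields.mapNT (fun _ => rfl) (he' w))⟩

theorem inf_mem_PEL {X Y : Language α} (hX : X ∈ PEL α) (hY : Y ∈ PEL α) : X ⊓ Y ∈ PEL α := by
  have := compl_mem_PEL (sup_mem_PEL (compl_mem_PEL hX) (compl_mem_PEL hY))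
  rwa [compl_sup, compl_compl, compl_compl] at this

theorem boolClosure_subset_PEL {C : Set (Language α)} (hC : C ⊆ PEL α) :
    boolClosure C ⊆ PEL α := by
  intro L hL
  induction hL with
  | base A hA => exact hC hA
  | union A B _ _ ihA ihB => exact sup_mem_PEL ihA ihB
  | inter A B _ _ ihA ihB => exact inf_mem_PEL ihA ihB
  | compl A _ ih => exact compl_mem_PEL ih

/-- As right factor, this language makes the inclusion of the regular closure in `PEL` a case of the
product statement. -/
theorem one_mem_PEL : (1 : Language α) ∈ PEL α := by
  refine mem_PEL_iff.2 ⟨⟨Unit, inferInstance, fun _ => .eps, ()⟩, .notPred .anyLetter, fun w => ?_⟩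
  refine (yields_anyLetter w).notPred.congr ?_
  cases w <;> simp [Language.mem_one]

end PEG

/-! ### Runs of deterministic pushdown automata -/

namespace DPDA

variable {α : Type u} {M : DPDA α}

/-- A sequence of moves. -/
abbrev Run (M : DPDA α) : M.Config → M.Config → Prop := Relation.ReflTransGen M.Move

theorem Move.unique {c c₁ c₂ : M.Config} (h₁ : M.Move c c₁) (h₂ : M.Move c c₂) : c₁ = c₂ := by
  cases h₁ with
  | read q p a w Z β γ h =>
    cases h₂ with
    | read _ p' _ _ _ β' _ h' =>
      rw [h] at h'
      cases h'
      rfl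
    | epsilon _ p' _ _ β' _ h' =>
      have := M.deterministic q Z (by simp [h']) a
      simp [this] at h
  | epsilon q p w Z β γ h =>
    cases h₂ with
    | read _ p' a _ _ β' _ h' =>
      have := M.deterministic q Z (by simp [h]) a
      simp [this] at h'
    | epsilon _ p' _ _ β' _ h' =>
      rw [h] at h'
      cases h'
      rfl

/-- The result of popping the whole stack is unique. -/
theorem Run.unique_of_empty {c : M.Config} {p p' : M.State} {s s' : List α}
    (h : M.Run c (p, s, [])) (h' : M.Run c (p', s', [])) : p = p' ∧ s = s' := by
  have hU : Relator.RightUnique M.Move := fun _ _ _ h₁ h₂ => h₁.unique h₂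
  -- No move is possible on an empty stack, so of two such configurations on one run neither lies
  -- strictly after the other.
  have hstuck : ∀ {p p' : M.State} {s s' : List α}, M.Run (p, s, []) (p', s', []) →
      p = p' ∧ s = s' := by
    intro p p' s s' h
    rcases h.cases_head with h | ⟨c, hc, _⟩
    · cases h
      exact ⟨rfl, rfl⟩
    · cases hc
  rcases Relation.ReflTransGen.total_of_right_unique hU h h' with h | h
  · exact hstuck h
  · exact ⟨(hstuck h).1.symm, (hstuck h).2.symm⟩

theorem Move.append_stack {q p : M.State} {w s : List α} {γ γ' : List M.StackSym}
    (h : M.Move (q, w, γ) (p, s, γ')) (δ : List M.StackSym) :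
    M.Move (q, w, γ ++ δ) (p, s, γ' ++ δ) := by
  cases h with
  | read _ _ a _ Z β γ h => simpa using Move.read q p a s Z β (γ ++ δ) h
  | epsilon _ _ _ Z β γ h => simpa using Move.epsilon q p w Z β (γ ++ δ) h

theorem Run.append_stack {q p : M.State} {w s : List α} {γ γ' : List M.StackSym}
    (h : M.Run (q, w, γ) (p, s, γ')) (δ : List M.StackSym) :
    M.Run (q, w, γ ++ δ) (p, s, γ' ++ δ) :=
  Relation.ReflTransGen.lift (r := M.Move) (fun c : M.Config => (c.1, c.2.1, c.2.2 ++ δ))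
    (fun _ _ h => Move.append_stack h δ) _ _ h

theorem Run.append_input {q p : M.State} {w s : List α} {γ γ' : List M.StackSym}
    (h : M.Run (q, w, γ) (p, s, γ')) (v : List α) :
    M.Run (q, w ++ v, γ) (p, s ++ v, γ') := by
  refine Relation.ReflTransGen.lift (r := M.Move)
    (fun c : M.Config => (c.1, c.2.1 ++ v, c.2.2)) (fun c d h => ?_) _ _ h
  cases h with
  | read q p a w Z β γ h => exact .read q p a (w ++ v) Z β γ h
  | epsilon q p w Z β γ h => exact .epsilon q p (w ++ v) Z β γ h

/-- A run never looks at the input beyond what it reads; together with `Run.append_input`, this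
translates between runs on an input with a remainder and runs on a factor. -/
theorem Run.exists_prefix {q p : M.State} {w s : List α} {γ γ' : List M.StackSym}
    (h : M.Run (q, w, γ) (p, s, γ')) : ∃ u, w = u ++ s ∧ M.Run (q, u, γ) (p, [], γ') := by
  generalize hc : (q, w, γ) = c at h
  induction h using Relation.ReflTransGen.head_induction_on generalizing q w γ with
  | refl =>
    cases hc
    exact ⟨[], rfl, .refl⟩
  | head hm _ ih =>
    subst hc
    cases hm with
    | read _ p' a w Z β γ hs =>
      obtain ⟨u, rfl, hu⟩ := ih rfl
      exact ⟨a :: u, rfl, hu.head (.read q p' a u Z β γ hs)⟩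
    | epsilon _ p' _ Z β γ hs =>
      obtain ⟨u, rfl, hu⟩ := ih rfl
      exact ⟨u, rfl, hu.head (.epsilon q p' u Z β γ hs)⟩

/-- A run either keeps the lower part `γ` of the stack or pops everything above it. -/
theorem Run.split_stack {q p : M.State} {w s : List α} {β γ γ' : List M.StackSym}
    (h : M.Run (q, w, β ++ γ) (p, s, γ')) :
    (∃ β', γ' = β' ++ γ ∧ M.Run (q, w, β) (p, s, β')) ∨
      ∃ q₁ s₁, M.Run (q, w, β) (q₁, s₁, []) ∧ M.Run (q₁, s₁, γ) (p, s, γ') := by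
  generalize hc : (q, w, β ++ γ) = c at h
  induction h using Relation.ReflTransGen.head_induction_on generalizing q w β with
  | refl =>
    cases hc
    exact .inl ⟨β, rfl, .refl⟩
  | head hm hr ih =>
    subst hc
    cases β with
    | nil => exact .inr ⟨q, w, .refl, hr.head hm⟩
    | cons Z β =>
      cases hm with
      | read _ p' a w _ δ _ hs =>
        have hm := Move.read q p' a w Z δ β hs
        rcases ih (congrArg (fun x => (p', w, x)) (List.append_assoc δ β γ)) with
          ⟨β', h₁, h₂⟩ | ⟨q₁, s₁, h₁, h₂⟩
        · exact .inl ⟨β', h₁, h₂.head hm⟩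
        · exact .inr ⟨q₁, s₁, h₁.head hm, h₂⟩
      | epsilon _ p' _ _ δ _ hs =>
        have hm := Move.epsilon q p' w Z δ β hs
        rcases ih (congrArg (fun x => (p', w, x)) (List.append_assoc δ β γ)) with
          ⟨β', h₁, h₂⟩ | ⟨q₁, s₁, h₁, h₂⟩
        · exact .inl ⟨β', h₁, h₂.head hm⟩
        · exact .inr ⟨q₁, s₁, h₁.head hm, h₂⟩

theorem run_cons_empty_iff {q p : M.State} {w s : List α} {Z : M.StackSym}
    {γ : List M.StackSym} : M.Run (q, w, Z :: γ) (p, s, []) ↔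
      ∃ q₁ s₁, M.Run (q, w, [Z]) (q₁, s₁, []) ∧ M.Run (q₁, s₁, γ) (p, s, []) := by
  constructor
  · intro h
    rcases Run.split_stack (β := [Z]) h with ⟨β', h₁, h₂⟩ | h
    · obtain ⟨rfl, rfl⟩ := List.append_eq_nil_iff.1 h₁.symm
      exact ⟨p, s, h₂, .refl⟩
    · exact h
  · rintro ⟨q₁, s₁, h₁, h₂⟩
    exact (h₁.append_stack γ).trans h₂

/-- The stack symbol `Z` may be rewritten on the empty word: a run from `(q, Z)` to `(p, γ)`. -/
def EpsRun (M : DPDA α) (q : M.State) (Z : M.StackSym) (p : M.State) (γ : List M.StackSym) :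
    Prop :=
  M.Run (q, [], [Z]) (p, [], γ)

theorem EpsRun.run {q p : M.State} {Z : M.StackSym} {γ : List M.StackSym}
    (h : M.EpsRun q Z p γ) (w : List α) : M.Run (q, w, [Z]) (p, w, γ) := by
  simpa using Run.append_input h w

theorem Run.epsRun {q p : M.State} {Z : M.StackSym} {w : List α} {γ : List M.StackSym}
    (h : M.Run (q, w, [Z]) (p, w, γ)) : M.EpsRun q Z p γ := by
  obtain ⟨u, hu, h⟩ := h.exists_prefix
  rwa [List.self_eq_append_left.1 hu] at h

theorem Run.length_le {c d : M.Config} (h : M.Run c d) : d.2.1.length ≤ c.2.1.length := by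
  obtain ⟨u, hu, _⟩ := Run.exists_prefix h
  simp [hu]

/-- From `(q, Z)` the automaton reaches `(p, γ)` by reading the letter `a` in its last move. -/
def ReadsTo (M : DPDA α) (q : M.State) (Z : M.StackSym) (a : α) (p : M.State)
    (γ : List M.StackSym) : Prop :=
  ∃ q' Z' β δ, M.EpsRun q Z q' (Z' :: β) ∧ M.step q' (some a) Z' = some (p, δ) ∧ γ = δ ++ β

theorem ReadsTo.run {q p : M.State} {Z : M.StackSym} {a : α} {γ : List M.StackSym}
    (h : M.ReadsTo q Z a p γ) (w : List α) : M.Run (q, a :: w, [Z]) (p, w, γ) := by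
  obtain ⟨q', Z', β, δ, h, hs, rfl⟩ := h
  exact (h.run _).tail (.read q' p a w Z' δ β hs)

/-- Both configurations from which `a` is read lie on the one run on the empty input. By determinism
a configuration about to read `a` has no move on the empty word, so the two coincide. -/
theorem ReadsTo.unique {q p p' : M.State} {Z : M.StackSym} {a : α} {γ γ' : List M.StackSym}
    (h : M.ReadsTo q Z a p γ) (h' : M.ReadsTo q Z a p' γ') : p = p' ∧ γ = γ' := by
  obtain ⟨q₁, Z₁, β₁, δ₁, h₁, hs₁, rfl⟩ := h
  obtain ⟨q₂, Z₂, β₂, δ₂, h₂, hs₂, rfl⟩ := h'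
  have hU : Relator.RightUnique M.Move := fun _ _ _ h₁ h₂ => h₁.unique h₂
  have hstuck : ∀ {q₁ q₂ p : M.State} {Z₁ Z₂ : M.StackSym} {β₁ β₂ δ : List M.StackSym},
      M.step q₁ (some a) Z₁ = some (p, δ) → M.Run (q₁, [], Z₁ :: β₁) (q₂, [], Z₂ :: β₂) →
      q₁ = q₂ ∧ Z₁ = Z₂ ∧ β₁ = β₂ := by
    intro q₁ q₂ p Z₁ Z₂ β₁ β₂ δ hs h
    rcases h.cases_head with h | ⟨c, hc, _⟩
    · cases h
      exact ⟨rfl, rfl, rfl⟩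
    · cases hc with
      | epsilon _ p' _ _ β' _ h' =>
        have := M.deterministic q₁ Z₁ (by simp [h']) a
        simp [this] at hs
  rcases Relation.ReflTransGen.total_of_right_unique hU h₁ h₂ with h | h
  · obtain ⟨rfl, rfl, rfl⟩ := hstuck hs₁ h
    rw [hs₁] at hs₂
    cases hs₂
    exact ⟨rfl, rfl⟩
  · obtain ⟨rfl, rfl, rfl⟩ := hstuck hs₂ h
    rw [hs₁] at hs₂
    cases hs₂
    exact ⟨rfl, rfl⟩

/-- A run that starts with one stack symbol reads nothing, or has a first letter that it reads. -/
theorem Run.first_read {q p : M.State} {w s : List α} {Z : M.StackSym} {γ : List M.StackSym}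
    (h : M.Run (q, w, [Z]) (p, s, γ)) :
    s = w ∨ ∃ a w' p' γ', w = a :: w' ∧ M.ReadsTo q Z a p' γ' ∧
      M.Run (p', w', γ') (p, s, γ) := by
  generalize hd : (p, s, γ) = d at h
  induction h generalizing p s γ with
  | refl =>
    cases hd
    exact .inl rfl
  | @tail c d h hm ih =>
    subst hd
    obtain ⟨q', w', γ'⟩ := c
    rcases ih rfl with rfl | ⟨a, w'', p', γ'', rfl, h₁, h₂⟩
    · cases hm with
      | read _ _ a _ Z' β γ hs =>
        exact .inr ⟨a, s, p, _, rfl, ⟨q', Z', γ, β, Run.epsRun h, hs, rfl⟩, .refl⟩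
      | epsilon => exact .inl rfl
    · exact .inr ⟨a, w'', p', γ'', rfl, h₁, h₂.tail hm⟩

/-- Some run on `w` from the state `q` and the stack `γ` reaches an accepting configuration where
the rest `s` of the input satisfies `P`. -/
def Accepts (M : DPDA α) (P : List α → Prop) (q : M.State) (γ : List M.StackSym) (w : List α) :
    Prop :=
  ∃ p ∈ M.accept, ∃ s γ', M.Run (q, w, γ) (p, s, γ') ∧ P s

/-- Acceptance comes before `Z` is removed, with nothing or with something read, or from the point
of its removal on. The condition on the automaton in the first case is independent of the input, so
a grammar can have it built in; the cases may overlap, which is harmless for tests. -/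
theorem accepts_cons_iff {P : List α → Prop} {q : M.State} {Z : M.StackSym}
    {γ : List M.StackSym} {w : List α} : M.Accepts P q (Z :: γ) w ↔
      ((∃ p ∈ M.accept, ∃ γ', M.EpsRun q Z p γ') ∧ P w) ∨
        M.Accepts (fun s => s ≠ w ∧ P s) q [Z] w ∨
          ∃ q₁ s, M.Run (q, w, [Z]) (q₁, s, []) ∧ M.Accepts P q₁ γ s := by
  constructor
  · rintro ⟨p, hp, s, γ', h, hs⟩
    rcases Run.split_stack (β := [Z]) h with ⟨β', -, h⟩ | ⟨q₁, s₁, h₁, h₂⟩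
    · by_cases hw : s = w
      · subst hw
        exact .inl ⟨⟨p, hp, β', h.epsRun⟩, hs⟩
      · exact .inr (.inl ⟨p, hp, s, β', h, hw, hs⟩)
    · exact .inr (.inr ⟨q₁, s₁, h₁, p, hp, s, γ', h₂, hs⟩)
  · rintro (⟨⟨p, hp, γ', h⟩, hw⟩ | ⟨p, hp, s, γ', h, -, hs⟩ | ⟨q₁, s, h, p, hp, t, γ', h', ht⟩)
    · exact ⟨p, hp, w, γ' ++ γ, (h.run w).append_stack γ, hw⟩
    · exact ⟨p, hp, s, γ' ++ γ, h.append_stack γ, hs⟩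
    · exact ⟨p, hp, t, γ', (h.append_stack γ).trans h', ht⟩

end DPDA

/-! ### Linear equations for a regular expression with substituted languages -/

namespace RegularExpression

variable {σ : Type v} {α : Type u}

/-- One step in the expansion of a sequence of regular expressions. A leading letter `i` may be
dropped if `ok i` holds. -/
inductive Expand (ok : σ → Prop) :
    List (RegularExpression σ) → List (RegularExpression σ) → Prop
  | epsilon (k : List (RegularExpression σ)) : Expand ok (.epsilon :: k) k
  | char (i : σ) (k : List (RegularExpression σ)) (h : ok i) : Expand ok (.char i :: k) k
  | plus_left (P Q : RegularExpression σ) (k : List (RegularExpression σ)) :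
      Expand ok (.plus P Q :: k) (P :: k)
  | plus_right (P Q : RegularExpression σ) (k : List (RegularExpression σ)) :
      Expand ok (.plus P Q :: k) (Q :: k)
  | comp (P Q : RegularExpression σ) (k : List (RegularExpression σ)) :
      Expand ok (.comp P Q :: k) (P :: Q :: k)
  | star_drop (P : RegularExpression σ) (k : List (RegularExpression σ)) :
      Expand ok (.star P :: k) k
  | star_unfold (P : RegularExpression σ) (k : List (RegularExpression σ)) :
      Expand ok (.star P :: k) (P :: .star P :: k)

/-- A finite set of sequences that contains all sequences reachable from `R :: k` by expansion,
up to the point where `R` is used up. -/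
def reachable : RegularExpression σ → List (RegularExpression σ) →
    Set (List (RegularExpression σ))
  | .zero, k => {.zero :: k, k}
  | .epsilon, k => {.epsilon :: k, k}
  | .char i, k => {.char i :: k, k}
  | .plus P Q, k => {.plus P Q :: k} ∪ (P.reachable k ∪ Q.reachable k)
  | .comp P Q, k => {.comp P Q :: k} ∪ (P.reachable (Q :: k) ∪ Q.reachable k)
  | .star P, k => {.star P :: k, k} ∪ P.reachable (.star P :: k)

theorem finite_reachable (R : RegularExpression σ) (k : List (RegularExpression σ)) :
    (R.reachable k).Finite := by
  induction R generalizing k with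
  | zero | epsilon | char => simp [reachable]
  | plus P Q ihP ihQ => simp [reachable, ihP, ihQ]
  | comp P Q ihP ihQ => simp [reachable, ihP, ihQ]
  | star P ih => simp [reachable, ih]

theorem cons_mem_reachable (R : RegularExpression σ) (k : List (RegularExpression σ)) :
    R :: k ∈ R.reachable k := by
  cases R <;> simp [reachable]

/-- The tail `k` is never touched before `R` is used up. Unfolding a star only puts its body before
the star itself, so repeated unfolding returns to the same sequences. -/
theorem Expand.mem_reachable {ok : σ → Prop} {R : RegularExpression σ}
    {k l l' : List (RegularExpression σ)} (hl : l ∈ R.reachable k) (h : Expand ok l l') :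
    l = k ∨ l' ∈ R.reachable k := by
  induction R generalizing k with
  | zero | epsilon | char =>
    rcases hl with rfl | rfl
    · cases h <;> simp [reachable]
    · exact .inl rfl
  | plus P Q ihP ihQ =>
    rcases hl with rfl | hl | hl
    · cases h with
      | plus_left => exact .inr (.inr (.inl (cons_mem_reachable P k)))
      | plus_right => exact .inr (.inr (.inr (cons_mem_reachable Q k)))
    · exact (ihP hl).imp id fun h => .inr (.inl h)
    · exact (ihQ hl).imp id fun h => .inr (.inr h)
  | comp P Q ihP ihQ =>
    rcases hl with rfl | hl | hl
    · cases h with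
      | comp => exact .inr (.inr (.inl (cons_mem_reachable P _)))
    · rcases ihP hl with rfl | h'
      · exact (ihQ (cons_mem_reachable Q k)).imp id fun h => .inr (.inr h)
      · exact .inr (.inr (.inl h'))
    · exact (ihQ hl).imp id fun h => .inr (.inr h)
  | star P ih =>
    have hstar : ∀ {l'}, Expand ok (.star P :: k) l' → l' ∈
        (RegularExpression.star P).reachable k := by
      intro l' h
      cases h with
      | star_drop => exact .inl (.inr rfl)
      | star_unfold => exact .inr (cons_mem_reachable P _)
    rcases hl with (rfl | rfl) | hl
    · exact .inr (hstar h)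
    · exact .inl rfl
    · rcases ih hl with rfl | h'
      · exact .inr (hstar h)
      · exact .inr (.inr h')

/-- The exceptional case is void, since the empty sequence has no expansion. -/
theorem Expand.mem_reachable_nil {ok : σ → Prop} {R : RegularExpression σ}
    {l l' : List (RegularExpression σ)} (hl : l ∈ R.reachable []) (h : Expand ok l l') :
    l' ∈ R.reachable [] :=
  (h.mem_reachable hl).resolve_left (by rintro rfl; cases h)

variable {f : σ → Language α} {X : Language α}

/-- The product of the languages of a sequence of regular expressions and the language `X`. -/
def seqLanguage (f : σ → Language α) (X : Language α) : List (RegularExpression σ) → Language α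
  | [] => X
  | R :: k => R.substLanguage f * seqLanguage f X k

/-- Expansion where letters whose language contains the empty word may be dropped. -/
abbrev EpsExpand (f : σ → Language α) :
    List (RegularExpression σ) → List (RegularExpression σ) → Prop :=
  Relation.ReflTransGen (Expand fun i => [] ∈ f i)

theorem Expand.seqLanguage_le {l l' : List (RegularExpression σ)}
    (h : Expand (fun i => [] ∈ f i) l l') : seqLanguage f X l' ≤ seqLanguage f X l := by
  have hdrop : ∀ (L Y : Language α), [] ∈ L → Y ≤ L * Y := fun L Y hL w hw =>
    Language.mem_mul.2 ⟨[], hL, w, hw, rfl⟩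
  cases h with
  | epsilon => simp [seqLanguage, substLanguage]
  | char i _ h => exact hdrop _ _ h
  | plus_left P Q k =>
    simp only [seqLanguage, substLanguage, add_mul]
    exact le_sup_left
  | plus_right P Q k =>
    simp only [seqLanguage, substLanguage, add_mul]
    exact le_sup_right
  | comp P Q k => simp [seqLanguage, substLanguage, mul_assoc]
  | star_drop P k => exact hdrop _ _ (Language.nil_mem_kstar _)
  | star_unfold P k =>
    simp only [seqLanguage, substLanguage, ← mul_assoc]
    gcongr
    exact mul_kstar_le_kstar

theorem EpsExpand.seqLanguage_le {l l' : List (RegularExpression σ)}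
    (h : EpsExpand f l l') : seqLanguage f X l' ≤ seqLanguage f X l := by
  induction h with
  | refl => exact le_rfl
  | tail _ h ih => exact h.seqLanguage_le.trans ih

/-- A word of `R` is empty, or its first nonempty factor from a language `f i` can be split off. -/
theorem exists_epsExpand_of_mem {R : RegularExpression σ} {u : List α}
    (hu : u ∈ R.substLanguage f) (k : List (RegularExpression σ)) :
    (u = [] ∧ EpsExpand f (R :: k) k) ∨
      ∃ i k' u₁ u₂, EpsExpand f (R :: k) (.char i :: k') ∧ u = u₁ ++ u₂ ∧ u₁ ∈ f i ∧ u₁ ≠ [] ∧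
        ∀ (Y : Language α), ∀ v ∈ seqLanguage f Y k, u₂ ++ v ∈ seqLanguage f Y k' := by
  induction R generalizing u k with
  | zero => exact hu.elim
  | epsilon => exact .inl ⟨hu, .single (.epsilon k)⟩
  | char i =>
    by_cases h : u = []
    · subst h
      exact .inl ⟨rfl, .single (.char i k hu)⟩
    · exact .inr ⟨i, k, u, [], .refl, by simp, hu, h, fun Y v hv => hv⟩
  | plus P Q ihP ihQ =>
    rcases hu with hu | hu
    · rcases ihP hu k with ⟨h, h'⟩ | ⟨i, k', u₁, u₂, h, h'⟩
      · exact .inl ⟨h, h'.head (.plus_left P Q k)⟩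
      · exact .inr ⟨i, k', u₁, u₂, h.head (.plus_left P Q k), h'⟩
    · rcases ihQ hu k with ⟨h, h'⟩ | ⟨i, k', u₁, u₂, h, h'⟩
      · exact .inl ⟨h, h'.head (.plus_right P Q k)⟩
      · exact .inr ⟨i, k', u₁, u₂, h.head (.plus_right P Q k), h'⟩
  | comp P Q ihP ihQ =>
    obtain ⟨x, hx, y, hy, rfl⟩ := Language.mem_mul.1 hu
    rcases ihP hx (Q :: k) with ⟨rfl, h⟩ | ⟨i, k', u₁, u₂, h, rfl, h₁, h₂, h₃⟩
    · have h := h.head (.comp P Q k)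
      rcases ihQ hy k with ⟨rfl, h'⟩ | ⟨i, k', u₁, u₂, h', h''⟩
      · exact .inl ⟨rfl, h.trans h'⟩
      · exact .inr ⟨i, k', u₁, u₂, h.trans h', h''⟩
    · refine .inr ⟨i, k', u₁, u₂ ++ y, h.head (.comp P Q k), by simp, h₁, h₂, fun Y v hv => ?_⟩
      rw [List.append_assoc]
      exact h₃ Y _ (Language.mem_mul.2 ⟨y, hy, v, hv, rfl⟩)
  | star P ih =>
    -- With nonempty factors only, one unfolding of the star reaches a factor that is really read.
    obtain ⟨L, rfl, hL⟩ := Language.mem_kstar_iff_exists_nonempty.1 hu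
    cases L with
    | nil => exact .inl ⟨rfl, .single (.star_drop P k)⟩
    | cons x L =>
      obtain ⟨hx, hx'⟩ := hL x (.head _)
      rcases ih hx (.star P :: k) with ⟨rfl, h⟩ | ⟨i, k', u₁, u₂, h, rfl, h₁, h₂, h₃⟩
      · exact (hx' rfl).elim
      · refine .inr ⟨i, k', u₁, u₂ ++ L.flatten, h.head (.star_unfold P k), by simp, h₁, h₂,
          fun Y v hv => ?_⟩
        rw [List.append_assoc]
        exact h₃ Y _ (Language.mem_mul.2 ⟨_, Language.join_mem_kstar
          fun y hy => (hL y (.tail _ hy)).1, v, hv, rfl⟩)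

/-- All empty factors are absorbed into `EpsExpand`. The resulting equations have only nonempty
leading factors, which keeps left recursion out of the grammar. -/
theorem mem_seqLanguage_iff {l : List (RegularExpression σ)} {w : List α} :
    w ∈ seqLanguage f X l ↔ (EpsExpand f l [] ∧ w ∈ X) ∨
      ∃ i k u v, EpsExpand f l (.char i :: k) ∧ w = u ++ v ∧ u ∈ f i ∧ u ≠ [] ∧
        v ∈ seqLanguage f X k := by
  constructor
  · intro hw
    induction l generalizing w with
    | nil => exact .inl ⟨.refl, hw⟩
    | cons R l ih =>
      obtain ⟨x, hx, y, hy, rfl⟩ := Language.mem_mul.1 hw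
      rcases exists_epsExpand_of_mem hx l with ⟨rfl, h⟩ | ⟨i, k', u₁, u₂, h, rfl, h₁, h₂, h₃⟩
      · rcases ih hy with ⟨h', hw⟩ | ⟨i, k, u, v, h', h''⟩
        · exact .inl ⟨h.trans h', hw⟩
        · exact .inr ⟨i, k, u, v, h.trans h', h''⟩
      · exact .inr ⟨i, k', u₁, u₂ ++ y, h, by simp, h₁, h₂, h₃ X y hy⟩
  · rintro (⟨h, hw⟩ | ⟨i, k, u, v, h, rfl, hu, -, hv⟩)
    · exact h.seqLanguage_le hw
    · exact h.seqLanguage_le (Language.mem_mul.2 ⟨u, hu, v, hv, rfl⟩)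

end RegularExpression

/-! ### A parsing expression grammar for a system over automata -/

instance {α : Type u} (M : DPDA α) : Finite M.State := M.finite_State

/-- A finite system of equations for languages, in which each right-hand side is a union of products
of the language of an automaton, without the empty word, and an unknown, and possibly of the
language that is tested by an expression of a grammar. -/
structure DPDASystem (α : Type u) where
  Label : Type
  finite_Label : Finite Label
  aut : Label → DPDA α
  Index : Type
  finite_Index : Finite Index
  edge : Index → Label → Index → Prop
  final : Index → Prop
  peg : PEG α
  expr : PExpr α peg.NT

namespace DPDASystem

variable {α : Type u} [Finite α] (D : DPDASystem α)

instance : Finite D.Label := D.finite_Label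

instance : Finite D.Index := D.finite_Index

/-- The nonterminals of the grammar of a system: those of the given grammar, and those that follow
the run of an automaton from a state and a stack symbol, either up to the removal of this symbol or
up to an accepting configuration where the rest of the input belongs to an unknown. -/
abbrev NT : Type :=
  D.peg.NT ⊕ ((i : D.Label) × (D.aut i).State × (D.aut i).StackSym × (D.aut i).State) ⊕
    ((i : D.Label) × D.Index × (D.aut i).State × (D.aut i).StackSym)

variable {D}

/-- The expression that consumes the input that is read in a run that starts in the state `q`,
removes the stack symbol `Z` and ends in the state `p`. -/
def pop {i : D.Label} (q : (D.aut i).State) (Z : (D.aut i).StackSym) (p : (D.aut i).State) :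
    PExpr α D.NT :=
  .nonterminal (.inr (.inl ⟨i, q, Z, p⟩))

/-- The expression that tests if a run from the state `q` and the stack symbol `Z` reads something
and then accepts, with a rest of the input that belongs to the unknown `k`. -/
def find {i : D.Label} (k : D.Index) (q : (D.aut i).State) (Z : (D.aut i).StackSym) :
    PExpr α D.NT :=
  .nonterminal (.inr (.inr ⟨i, k, q, Z⟩))

/-- The variant of `pop` for a whole stack. -/
noncomputable def popAll {i : D.Label} :
    (D.aut i).State → List (D.aut i).StackSym → (D.aut i).State → PExpr α D.NT
  | q, [], p => .guard (q = p)
  | q, Z :: γ, p => .anyOf ((allElems (D.aut i).State).map fun q₁ =>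
      .seq (pop q Z q₁) (popAll q₁ γ p))

/-- The expression that tests if the input belongs to the unknown `k`. -/
noncomputable def test (k : D.Index) : PExpr α D.NT :=
  .choice (.seq (.guard (D.final k)) (D.expr.mapNT .inl))
    (.anyOf ((allElems (D.Label × D.Index)).map fun j =>
      .seq (.guard (D.edge k j.1 j.2)) (find j.2 (D.aut j.1).start (D.aut j.1).bottom)))

/-- The variant of `find` for a whole stack, where nothing need be read. -/
noncomputable def findAll {i : D.Label} (k : D.Index) :
    (D.aut i).State → List (D.aut i).StackSym → PExpr α D.NT
  | q, [] => .seq (.guard (q ∈ (D.aut i).accept)) (test k)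
  | q, Z :: γ =>
    .choice (.seq (.guard (∃ p ∈ (D.aut i).accept, ∃ γ', (D.aut i).EpsRun q Z p γ')) (test k))
      (.choice (find k q Z) (.anyOf ((allElems (D.aut i).State).map fun q₁ =>
        .andPred (.seq (pop q Z q₁) (findAll k q₁ γ)))))

open Classical in
/-- The expression that reads the next letter, as the automaton `M` does from the state `q` and the
stack symbol `Z`, and continues with the expression for the resulting state and stack. -/
noncomputable def afterRead {N : Type} {M : DPDA α} (q : M.State) (Z : M.StackSym)
    (e : M.State → List M.StackSym → PExpr α N) : PExpr α N :=
  .anyOf ((allElems α).map fun a =>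
    if h : ∃ c : M.State × List M.StackSym, M.ReadsTo q Z a c.1 c.2 then
      .seq (.terminal a) (e h.choose.1 h.choose.2)
    else .fail)

variable (D) in
open Classical in
/-- The grammar of a system. -/
noncomputable abbrev grammar : PEG α where
  NT := D.NT
  finite_NT := by
    have := D.peg.finite_NT
    have := fun i => (D.aut i).finite_StackSym
    infer_instance
  rule
    | .inl A => (D.peg.rule A).mapNT .inl
    | .inr (.inl ⟨i, q, Z, p⟩) =>
      -- If `Z` can be removed without reading, determinism excludes any other outcome. Otherwise a
      -- run that removes `Z` and ends in `p` has to read a letter.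
      if (D.aut i).EpsRun q Z p [] then .eps else afterRead q Z fun q' γ => popAll q' γ p
    | .inr (.inr ⟨i, k, q, Z⟩) => .andPred (afterRead q Z (findAll k))
  start := .inl D.peg.start

/-- At most one alternative applies, since the next letter is given, and `ReadsTo.unique` makes the
chosen state and stack the only possible ones. -/
theorem yields_afterRead {G : PEG α} {M : DPDA α} {q : M.State} {Z : M.StackSym}
    {e : M.State → List M.StackSym → PExpr α G.NT} {w : List α}
    {S : M.State → List M.StackSym → List α → List α → Prop}
    (h : ∀ a w' p γ, w = a :: w' → M.ReadsTo q Z a p γ → G.Yields (e p γ) w' (S p γ w')) :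
    G.Yields (afterRead q Z e) w fun s =>
      ∃ a w' p γ, w = a :: w' ∧ M.ReadsTo q Z a p γ ∧ S p γ w' s := by
  classical
  refine (PEG.Yields.anyOf (l := allElems α) (S := fun a s => ∃ w' p γ, w = a :: w' ∧
    M.ReadsTo q Z a p γ ∧ S p γ w' s) (fun a _ => ?_) ?_).congr (by simp [mem_allElems])
  · split_ifs with hc
    · have hr := hc.choose_spec
      refine ((PEG.yields_terminal a w).seq fun w' hw => h a w' _ _ hw hr).congr fun s => ?_
      constructor
      · rintro ⟨w', hw, hs⟩
        exact ⟨w', _, _, hw, hr, hs⟩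
      · rintro ⟨w', p, γ, hw, hr', hs⟩
        obtain ⟨rfl, rfl⟩ := hr'.unique hr
        exact ⟨w', hw, hs⟩
    · refine (PEG.yields_fail w).congr fun s => ⟨False.elim, ?_⟩
      rintro ⟨w', p, γ, -, hr, -⟩
      exact hc ⟨(p, γ), hr⟩
  · rintro a _ b _ s t ⟨w', p, γ, hw, hr, hs⟩ ⟨w'', p', γ', hw', hr', ht⟩
    cases hw.symm.trans hw'
    obtain ⟨rfl, rfl⟩ := hr.unique hr'
    exact (h a w' p γ hw hr).unique hs ht

variable (D) in
/-- The language `X` and the family `Y` satisfy the equations of the system `D`. -/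
structure IsSolution (X : Language α) (Y : D.Index → Language α) : Prop where
  expr_tests : ∀ w, D.peg.Tests D.expr w (w ∈ X)
  mem_iff : ∀ k w, w ∈ Y k ↔ (D.final k ∧ w ∈ X) ∨
    ∃ i k' u v, D.edge k i k' ∧ w = u ++ v ∧ u ∈ (D.aut i).language ∧ u ≠ [] ∧ v ∈ Y k'

/-- The nonterminals that follow the runs of automata have the right results on `w`. -/
structure CorrectAt (Y : D.Index → Language α) (w : List α) : Prop where
  pop : ∀ (i : D.Label) (q : (D.aut i).State) (Z : (D.aut i).StackSym) (p : (D.aut i).State),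
    D.grammar.Yields (pop q Z p) w fun s => (D.aut i).Run (q, w, [Z]) (p, s, [])
  find : ∀ (i : D.Label) (k : D.Index) (q : (D.aut i).State) (Z : (D.aut i).StackSym),
    D.grammar.Tests (find k q Z) w ((D.aut i).Accepts (fun s => s ≠ w ∧ s ∈ Y k) q [Z] w)

variable {X : Language α} {Y : D.Index → Language α}

/-- The choice of the intermediate state `q₁` is no guess: by determinism at most one `q₁` arises.
Correctness is assumed on all words that are not longer, because removing `Z` may read nothing. -/
theorem yields_popAll {i : D.Label} {q p : (D.aut i).State} {γ : List (D.aut i).StackSym}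
    {w : List α} (hw : ∀ s : List α, s.length ≤ w.length → CorrectAt Y s) :
    D.grammar.Yields (popAll q γ p) w fun s => (D.aut i).Run (q, w, γ) (p, s, []) := by
  induction γ generalizing q w with
  | nil =>
    refine PEG.Yields.congr (PEG.tests_guard w (q = p)) fun s => ⟨?_, fun h => ?_⟩
    · rintro ⟨rfl, rfl⟩
      exact .refl
    · obtain ⟨h₁, h₂⟩ := DPDA.Run.unique_of_empty .refl h
      exact ⟨h₂.symm, h₁⟩
  | cons Z γ ih =>
    refine (PEG.Yields.anyOf (fun q₁ _ => ((hw w le_rfl).pop i q Z q₁).seq fun s hs =>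
      ih (q := q₁) fun t ht => hw t (ht.trans hs.length_le)) ?_).congr fun s => ?_
    · rintro q₁ _ q₂ _ s t ⟨s', h₁, h₂⟩ ⟨t', h₃, h₄⟩
      obtain ⟨rfl, rfl⟩ := h₁.unique_of_empty h₃
      exact (h₂.unique_of_empty h₄).2
    · rw [DPDA.run_cons_empty_iff]
      simp [mem_allElems]

theorem IsSolution.tests_test (hY : D.IsSolution X Y) {w : List α} (hw : CorrectAt Y w)
    (k : D.Index) : D.grammar.Tests (test k) w (w ∈ Y k) := by
  refine (((PEG.tests_guard w _).seq fun _ => PEG.Yields.mapNT (H := D.grammar)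
    (fun _ => rfl) (hY.expr_tests w)).choice (PEG.Tests.anyOf fun j _ =>
      (PEG.tests_guard w _).seq fun _ => hw.find j.1 j.2 _ _)).congr ?_
  rw [hY.mem_iff]
  refine or_congr Iff.rfl ?_
  constructor
  · rintro ⟨⟨i, k'⟩, -, he, p, hp, s, γ, hr, hs, hsY⟩
    obtain ⟨u, rfl, hu⟩ := hr.exists_prefix
    exact ⟨i, k', u, s, he, rfl, ⟨p, hp, γ, hu⟩, by rintro rfl; exact hs rfl, hsY⟩
  · rintro ⟨i, k', u, v, he, rfl, ⟨p, hp, γ, hr⟩, hu, hv⟩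
    refine ⟨(i, k'), mem_allElems _, he, p, hp, v, γ, by
      simpa using DPDA.Run.append_input hr v, ?_, hv⟩
    simpa using hu

/-- The cases of `DPDA.accepts_cons_iff` become alternatives. The and-predicate around the last one
undoes the consumption by `pop`, so that all alternatives are tests and an early success hides no
later one. -/
theorem IsSolution.tests_findAll (hY : D.IsSolution X Y) {i : D.Label} {k : D.Index}
    {q : (D.aut i).State} {γ : List (D.aut i).StackSym} {w : List α}
    (hw : ∀ s : List α, s.length ≤ w.length → CorrectAt Y s) :
    D.grammar.Tests (findAll k q γ) w ((D.aut i).Accepts (· ∈ Y k) q γ w) := by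
  induction γ generalizing q w with
  | nil =>
    refine ((PEG.tests_guard w _).seq fun _ => hY.tests_test (hw w le_rfl) k).congr ?_
    constructor
    · rintro ⟨hq, h⟩
      exact ⟨q, hq, w, [], .refl, h⟩
    · rintro ⟨p, hp, s, γ', h, hs⟩
      rcases h.cases_head with h | ⟨c, hc, _⟩
      · cases h
        exact ⟨hp, hs⟩
      · cases hc
  | cons Z γ ih =>
    rw [DPDA.accepts_cons_iff]
    refine ((PEG.tests_guard w _).seq fun _ => hY.tests_test (hw w le_rfl) k).choice
      (((hw w le_rfl).find i k q Z).choice ?_)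
    refine (PEG.Tests.anyOf fun q₁ _ => (((hw w le_rfl).pop i q Z q₁).seq fun s hs =>
      ih (q := q₁) fun t ht => hw t (ht.trans hs.length_le)).andPred).congr ?_
    simp [mem_allElems]

/-- Both kinds of rules read a letter before they refer to other nonterminals of these kinds, so
only strictly shorter words matter; the exception is a rule `ε`. -/
theorem IsSolution.correctAt (hY : D.IsSolution X Y) (w : List α) : CorrectAt Y w := by
  induction hn : w.length using Nat.strong_induction_on generalizing w with
  | _ n ih =>
    subst hn
    have hlt : ∀ (a : α) (w' : List α), w = a :: w' →
        ∀ s : List α, s.length ≤ w'.length → CorrectAt Y s := by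
      rintro a w' rfl s hs
      exact ih s.length (by simpa using Nat.lt_succ_of_le hs) s rfl
    refine ⟨fun i q Z p => .nonterminal ?_, fun i k q Z => .nonterminal ?_⟩
    · classical
      show D.grammar.Yields (if _ then _ else _) w _
      split_ifs with hp
      · refine (PEG.yields_eps w).congr fun s => ⟨?_, fun h => ?_⟩
        · rintro rfl
          exact hp.run s
        · exact (h.unique_of_empty (hp.run w)).2
      · refine (yields_afterRead fun a w' p' γ h _ => yields_popAll (hlt a w' h)).congr
          fun s => ⟨?_, fun h => ?_⟩
        · rintro ⟨a, w', p', γ, rfl, hr, h⟩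
          exact (hr.run w').trans h
        -- A removal of `Z` without reading was excluded by the case distinction.
        · refine h.first_read.resolve_left ?_
          rintro rfl
          exact hp h.epsRun
    · refine (yields_afterRead fun a w' p' γ h _ =>
        hY.tests_findAll (k := k) (hlt a w' h)).andPred.congr ⟨?_, ?_⟩
      · rintro ⟨s, a, w', p', γ, rfl, hr, rfl, p, hp, t, γ', h, ht⟩
        refine ⟨p, hp, t, γ', (hr.run s).trans h, ?_, ht⟩
        rintro rfl
        simpa using h.length_le
      · rintro ⟨p, hp, s, γ', h, hs, hsY⟩
        obtain ⟨a, w', p', γ'', hw, hr, h'⟩ := h.first_read.resolve_left hs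
        exact ⟨w', a, w', p', γ'', hw, hr, rfl, p, hp, s, γ', h', hsY⟩

theorem IsSolution.mem_PEL (hY : D.IsSolution X Y) (k : D.Index) : Y k ∈ PEL α :=
  PEG.mem_PEL_iff.2 ⟨D.grammar, test k, fun w => hY.tests_test (hY.correctAt w) k⟩

end DPDASystem

/-! ### The two inclusions -/

/-- Regular expressions over deterministic context-free languages, followed by a parsing expression
language, describe parsing expression languages. -/
theorem substLanguage_mul_mem_PEL {α : Type u} [Finite α] {m : ℕ} {f : Fin m → Language α}
    (hf : ∀ i, f i ∈ DCFL α) (R : RegularExpression (Fin m)) {X : Language α}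
    (hX : X ∈ PEL α) : R.substLanguage f * X ∈ PEL α := by
  choose M hM using hf
  obtain ⟨G, e, he⟩ := PEG.mem_PEL_iff.1 hX
  let D : DPDASystem α :=
    { Label := Fin m
      finite_Label := inferInstance
      aut := M
      Index := R.reachable []
      finite_Index := R.finite_reachable []
      edge := fun k i k' => RegularExpression.EpsExpand f k (.char i :: k')
      final := fun k => RegularExpression.EpsExpand f k []
      peg := G
      expr := e }
  have hmem : ∀ {k k' : List (RegularExpression (Fin m))}, k ∈ R.reachable [] →
      RegularExpression.EpsExpand f k k' → k' ∈ R.reachable [] := by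
    intro k k' hk h
    induction h with
    | refl => exact hk
    | tail _ h ih => exact h.mem_reachable_nil ih
  have hD : D.IsSolution X fun k => RegularExpression.seqLanguage f X k.1 := by
    refine ⟨he, fun k w => ?_⟩
    rw [RegularExpression.mem_seqLanguage_iff]
    refine or_congr Iff.rfl ⟨?_, ?_⟩
    · rintro ⟨i, k', u, v, h, rfl, hu, hu', hv⟩
      -- Here the letter `i` is dropped because a nonempty factor for it was read, whether or not `f
      -- i` contains the empty word; hence the condition that always holds.
      exact ⟨i, ⟨k', (RegularExpression.Expand.char (ok := fun _ => True) i k'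
        trivial).mem_reachable_nil (hmem k.2 h)⟩, u, v, h, rfl, (hM i).symm ▸ hu, hu', hv⟩
    · rintro ⟨i, k', u, v, h, rfl, hu, hu', hv⟩
      exact ⟨i, k', u, v, h, rfl, hM i ▸ hu, hu', hv⟩
  exact hD.mem_PEL ⟨[R], R.cons_mem_reachable []⟩

theorem concatClass_regClosure_DCFL_subset {α : Type u} [Finite α] :
    concatClass (regClosure (DCFL α)) (PEL α) ⊆ PEL α := by
  rintro _ ⟨_, ⟨m, R, f, hf, rfl⟩, X, hX, rfl⟩
  exact substLanguage_mul_mem_PEL hf R hX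

theorem regClosure_DCFL_subset_PEL {α : Type u} [Finite α] : regClosure (DCFL α) ⊆ PEL α :=
  fun L hL => concatClass_regClosure_DCFL_subset ⟨L, hL, 1, PEG.one_mem_PEL, mul_one L⟩

theorem mainTheorem1 {α : Type*} [Finite α] :
    boolClosure (regClosure (DCFL α)) ⊆ PEL α ∧
      concatClass (regClosure (DCFL α)) (PEL α) = PEL α := by
  refine ⟨PEG.boolClosure_subset_PEL regClosure_DCFL_subset_PEL,
    concatClass_regClosure_DCFL_subset.antisymm fun X hX => ?_⟩
  -- The left factor `{ε}` is given by the expression `ε` over the empty alphabet, so no language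
  -- needs to be substituted.
  exact ⟨1, ⟨0, .epsilon, Fin.elim0, fun i => i.elim0, rfl⟩, X, hX, one_mul X⟩
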